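/- A partial linear space consists of a non-empty set of points and a family of proper subsets, called lines, such that every line contains at least two points, every point lies on a line, and two distinct points lie on at most one common line; they are collinear if such a line exists (a point is regarded as collinear to itself). A subspace is a set of points containing the line joining any two distinct collinear points of it; it is singular if any two distinct points of it are collinear; $\langle X\rangle$ is the smallest subspace containing $X$. A polar space is a partial linear space in which every line has at least three points, no point is collinear to all points, every point is collinear to exactly one or to all points of any given line, and every chain of mutually distinct incident singular subspaces is finite. A thin polar space is one isomorphic to the geometry with point set $\{\pm1,\dots,\pm m\}$, for some $m$, whose lines are the pairs $\{i,j\}$ with $i\ne j$ and $j\neq -i$. Singular subspaces have their projective dimension ($\dim\emptyset=-1$, points have dimension $0$), and the rank is $n$ if the largest dimension of a singular subspace is $n-1$. For a polar space (or thin polar space) $\Pi$ of rank $n$ and $0\le k\le n-1$, the graph $\Gamma_k(\Pi)$ has as vertices the $k$-dimensional singular subspaces; for $k\le n-2$ two distinct vertices are adjacent if some $(k+1)$-dimensional singular subspace contains both, and for $k=n-1$ if their intersection is $(n-2)$-dimensional. A star of $k$-dimensional singular subspaces is a set $[S,U]_k$ of all $k$-dimensional singular subspaces $X$ with $S\subset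 X\subset U$, where $S\subset U$ are singular, $\dim S=k-1$ and $\dim U=n-1$. For a singular subspace $S$, $[S\rangle_k$ is the set of all $k$-dimensional singular subspaces containing $S$. For $\dim S=m$, $\Pi_S$ denotes the quotient geometry whose points are the elements of $[S\rangle_{m+1}$ and whose lines are the sets $[S,U]_{m+1}$ with $S\subset U$ and $\dim U=m+2$ (for $S=\emptyset$ this is $\Pi$). An $i$-dimensional singular subspace of $\Pi_S$ is identified with the $(m+1+i)$-dimensional singular subspace $V\supset S$ of $\Pi$ for which it equals $[S,V]_{m+1}$. Let $\Pi$ be a polar space or a thin polar space of rank $n$, let $\Pi'$ be a polar space of rank $n'$, let $1\le k\le n-3$ and $0\le k'\le n'-1$, and let $f$ be an isometric embedding of $\Gamma_k(\Pi)$ in $\Gamma_{k'}(\Pi')$, that is, an injection of vertex sets which preserves adjacency, non-adjacency and distance. Suppose that $f$ sends every star of $\Pi$ into some star of $\Pi'$. Then $$n-k\le n'-k'$$ and there is a $(k'-k-1)$-dimensional singular subspace $S$ of $\Pi'$ (in particular $k\le k'$) such that the image of $f$ is contained in $[S\rangle_{k'}$ and $f$ is induced by a collinearity preserving injection of $\Pi$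 to $\Pi'_S$: there is an injection $g$ from the points of $\Pi$ to the points of $\Pi'_S$ which sends collinear points to collinear points and non-collinear points to non-collinear points, such that for every $k$-dimensional singular subspace $X$ of $\Pi$ the span $\langle g(X)\rangle$ in $\Pi'_S$ is the $k$-dimensional singular subspace of $\Pi'_S$ identified with $f(X)$. -/

import Mathlib

/-- A point-line geometry on the point set `P`: a family of subsets of `P`, called lines. -/
structure PointLineGeometry (P : Type*) where
  /-- The family of lines. -/
  lines : Set (Set P)

namespace PointLineGeometry

variable {P : Type*} (G : PointLineGeometry P)

/-- The points `x` and `y` lie on a common line.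
When every point lies on some line, each point is collinear to itself. -/
def Collinear (x y : P) : Prop :=
  ∃ L ∈ G.lines, x ∈ L ∧ y ∈ L

/-- Partial linear spaces. -/
structure IsPartialLinearSpace : Prop where
  nonempty : Nonempty P
  line_ne_univ : ∀ L ∈ G.lines, L ≠ Set.univ
  line_nontrivial : ∀ L ∈ G.lines, L.Nontrivial
  exists_line : ∀ x : P, ∃ L ∈ G.lines, x ∈ L
  line_unique : ∀ x y : P, x ≠ y → ∀ L ∈ G.lines, ∀ M ∈ G.lines,
    x ∈ L → y ∈ L → x ∈ M → y ∈ M → L = M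

/-- A subspace contains the line joining any two distinct collinear points of it. -/
def IsSubspace (S : Set P) : Prop :=
  ∀ L ∈ G.lines, ∀ x ∈ L, ∀ y ∈ L, x ≠ y → x ∈ S → y ∈ S → L ⊆ S

/-- A singular subspace is a subspace whose distinct points are mutually collinear. -/
def IsSingular (S : Set P) : Prop :=
  G.IsSubspace S ∧ ∀ x ∈ S, ∀ y ∈ S, x ≠ y → G.Collinear x y

/-- The subspace `⟨X⟩` spanned by `X`: the smallest subspace containing `X`. -/
def span (X : Set P) : Set P :=
  ⋂₀ {S | G.IsSubspace S ∧ X ⊆ S}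

/-- The axioms of a polar space. -/
structure IsPolarSpace : Prop extends G.IsPartialLinearSpace where
  three_points : ∀ L ∈ G.lines, ∃ x ∈ L, ∃ y ∈ L, ∃ z ∈ L, x ≠ y ∧ y ≠ z ∧ x ≠ z
  no_radical : ¬ ∃ x : P, ∀ y : P, G.Collinear x y
  one_or_all : ∀ x : P, ∀ L ∈ G.lines,
    (∃! y, y ∈ L ∧ G.Collinear x y) ∨ ∀ y ∈ L, G.Collinear x y
  finite_chains : ∀ C : Set (Set P), (∀ S ∈ C, G.IsSingular S) →
    IsChain (· ⊆ ·) C → C.Finite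

/-- `G` is isomorphic to the geometry with point set `{±1, …, ±m}`, for some `m`, whose lines are
the pairs `{i, j}` with `i ≠ j` and `j ≠ -i`. Here `±i` is modelled by `(i, true)`, `(i, false)`. -/
def IsThinPolarSpace : Prop :=
  ∃ (m : ℕ) (e : P ≃ Fin m × Bool), ∀ L : Set P,
    L ∈ G.lines ↔ ∃ i j : Fin m × Bool, i ≠ j ∧ j ≠ (i.1, !i.2) ∧ e '' L = {i, j}

/-- `S` is a singular subspace of dimension `d`, i.e. the longest strictly increasing chains of
singular subspaces which end in `S` have `d + 1` steps. They start at the empty set, whose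
dimension is `-1`; points have dimension `0`. -/
def HasDim (S : Set P) (d : ℤ) : Prop :=
  ∃ h : G.IsSingular S, ∃ m : ℕ,
    Order.height (⟨S, h⟩ : {T : Set P // G.IsSingular T}) = (m : ℕ∞) ∧ d = (m : ℤ) - 1

/-- The rank is `n`: the largest dimension of a singular subspace is `n - 1`. -/
def HasRank (n : ℕ) : Prop :=
  IsGreatest {d : ℤ | ∃ S : Set P, G.HasDim S d} ((n : ℤ) - 1)

/-- The Grassmannian of the `k`-dimensional singular subspaces. -/
def Grassmannian (k : ℤ) : Type _ :=
  {X : Set P // G.HasDim X k}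

/-- The polar Grassmann graph `Γ_k` of a geometry of rank `n`. -/
def grassmannGraph (n k : ℕ) : SimpleGraph (G.Grassmannian k) where
  Adj X Y := X ≠ Y ∧
    ((k + 1 < n ∧ ∃ U : Set P, G.HasDim U ((k : ℤ) + 1) ∧ X.1 ⊆ U ∧ Y.1 ⊆ U) ∨
      (k + 1 = n ∧ G.HasDim (X.1 ∩ Y.1) ((k : ℤ) - 1)))
  symm := ⟨by
    rintro X Y ⟨hne, h⟩
    refine ⟨hne.symm, ?_⟩
    rcases h with ⟨hk, U, hU, hX, hY⟩ | ⟨hk, h⟩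
    · exact Or.inl ⟨hk, U, hU, hY, hX⟩
    · exact Or.inr ⟨hk, by rwa [Set.inter_comm]⟩⟩
  loopless := ⟨fun _ h => h.1 rfl⟩

/-- A star `[S, U]_k` in a geometry of rank `n`, where `dim S = k - 1` and `dim U = n - 1`. -/
def IsStar (n k : ℕ) (𝒳 : Set (G.Grassmannian k)) : Prop :=
  ∃ S U : Set P, G.HasDim S ((k : ℤ) - 1) ∧ G.HasDim U ((n : ℤ) - 1) ∧ S ⊆ U ∧
    𝒳 = {X | S ⊆ X.1 ∧ X.1 ⊆ U}

/-- The set `[S⟩_k` of all `k`-dimensional singular subspaces containing `S`. -/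
def bigStar (S : Set P) (k : ℤ) : Set (Set P) :=
  {X | G.HasDim X k ∧ S ⊆ X}

/-- The quotient geometry by a `(k - 1)`-dimensional singular subspace `S`. Its points are the
elements of `[S⟩_k` and its lines are the sets `[S, U]_k` with `S ⊆ U` and `dim U = k + 1`. -/
def quotient (S : Set P) (k : ℤ) : PointLineGeometry (G.bigStar S k) where
  lines := {ℓ | ∃ U : Set P, G.HasDim U (k + 1) ∧ S ⊆ U ∧ ℓ = {X | X.1 ⊆ U}}

/-- An injection sending collinear points to collinear points and non-collinear points to
non-collinear points. -/
def IsCollinearityPreservingInjection {Q : Type*} (H : PointLineGeometry Q) (g : P → Q) : Prop :=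
  Function.Injective g ∧ ∀ x y : P, x ≠ y → (G.Collinear x y ↔ H.Collinear (g x) (g y))

end PointLineGeometry

/-! For a singular subspace A of dimension at most k, let F(A), formally `meetImage f A`, be the
intersection of all f(X) with X ⊇ A. Everything rests on the formula dim F(A) = k' - k + dim A
(`dim_meetImage`). It yields S = F(∅) and g(p) = F({p}), and dim S ≥ -1 gives k ≤ k'.

The formula is proved by induction on k - dim A. Let X and Y be distinct perpendicular singular
subspaces containing A as a hyperplane. Then F(X) ∩ F(Y) has the expected dimension: if dim X = k
because f maps stars into stars, otherwise because F(X) and F(Y) are distinct hyperplanes of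
F(⟨X,Y⟩). They are distinct since equal ones would bring certain f(X₁), f(X₂) closer than X₁, X₂ are
(`meetImage_ne`). For mutually perpendicular X, Y, Z with Z not inside ⟨X,Y⟩, the pairwise
intersections agree. The residue of A has rank at least 3, because dim A < k ≤ n - 3, and there this
local agreement spreads to all subspaces over A (`exists_inter_subset`). Hence F(A) = F(X) ∩ F(Y).

Non-collinear points p, q are handled by two k-subspaces through p and q over a common B ⊆ p^⊥ ∩
q^⊥: if F({p}) ⊥ F({q}), their images would be adjacent (`collinear_iff`). The rank inequality comes
from a strictly increasing chain of singular subspaces spanned by the F({p}) (`rank_sub_le`).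

Polar and thin polar spaces are treated together through `IsWeakPolarSpace`, which allows lines with
two points. Their dimension theory is developed from the hyperplanes S ∩ z^⊥. -/

namespace PointLineGeometry

/-! ### Perps, spans and the double perp property. -/

variable {P : Type*} {G : PointLineGeometry P}

/-- The set of all points collinear to every point of `A`. -/
def perp (G : PointLineGeometry P) (A : Set P) : Set P := {x | ∀ a ∈ A, G.Collinear x a}

/-- The common properties of polar spaces and thin polar spaces of rank at least two. -/
structure IsWeakPolarSpace (G : PointLineGeometry P) : Prop where
  refl : ∀ x : P, G.Collinear x x
  no_radical : ∀ x : P, ∃ y : P, ¬ G.Collinear x y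
  line_perp : ∀ L ∈ G.lines, ∀ x, ∀ a ∈ L, ∀ b ∈ L, a ≠ b → G.Collinear x a → G.Collinear x b →
    ∀ c ∈ L, G.Collinear x c
  exists_perp : ∀ x : P, ∀ L ∈ G.lines, L.Nonempty → ∃ y ∈ L, G.Collinear x y
  finite_chains : ∀ C : Set (Set P), (∀ S ∈ C, G.IsSingular S) →
    IsChain (· ⊆ ·) C → C.Finite

theorem Collinear.symm {x y : P} (h : G.Collinear x y) : G.Collinear y x := by
  obtain ⟨L, hL, hx, hy⟩ := h
  exact ⟨L, hL, hy, hx⟩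

theorem perp_anti {A B : Set P} (h : A ⊆ B) : G.perp B ⊆ G.perp A :=
  fun _ hx a ha => hx a (h ha)

theorem subset_perp_comm {A B : Set P} : A ⊆ G.perp B ↔ B ⊆ G.perp A :=
  ⟨fun h _ hb _ ha => (h ha _ hb).symm, fun h _ ha _ hb => (h hb _ ha).symm⟩

theorem subset_span (A : Set P) : A ⊆ G.span A :=
  fun _ ha _ hS => hS.2 ha

theorem span_subset {A S : Set P} (hS : G.IsSubspace S) (h : A ⊆ S) : G.span A ⊆ S :=
  fun _ hx => hx S ⟨hS, h⟩

theorem span_mono {A B : Set P} (h : A ⊆ B) : G.span A ⊆ G.span B :=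
  fun _ hx S hS => hx S ⟨hS.1, h.trans hS.2⟩

theorem isSubspace_span (A : Set P) : G.IsSubspace (G.span A) :=
  fun L hL x hx y hy hxy hxS hyS _ hz S hS =>
    hS.1 L hL x hx y hy hxy (hxS S hS) (hyS S hS) hz

theorem IsSubspace.inter {S T : Set P} (hS : G.IsSubspace S) (hT : G.IsSubspace T) :
    G.IsSubspace (S ∩ T) :=
  fun L hL x hx y hy hxy hxS hyS _ hz =>
    ⟨hS L hL x hx y hy hxy hxS.1 hyS.1 hz, hT L hL x hx y hy hxy hxS.2 hyS.2 hz⟩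

theorem IsSubspace.span_eq {S : Set P} (hS : G.IsSubspace S) : G.span S = S :=
  (span_subset hS subset_rfl).antisymm (subset_span S)

theorem IsSingular.subset_of_inter {S T : Set P} (hS : G.IsSingular S) (hT : G.IsSubspace T) :
    G.IsSingular (S ∩ T) :=
  ⟨hS.1.inter hT, fun x hx y hy => hS.2 x hx.1 y hy.1⟩

theorem isSingular_empty : G.IsSingular (∅ : Set P) :=
  ⟨fun _ _ _ _ _ _ _ h => h.elim, fun _ h => h.elim⟩

theorem mem_of_line {S L : Set P} {a b c : P} (hS : G.IsSubspace S) (hL : L ∈ G.lines)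
    (ha : a ∈ L) (hb : b ∈ L) (hc : c ∈ L) (hab : a ≠ b) (haS : a ∈ S) (hbS : b ∈ S) : c ∈ S :=
  hS L hL a ha b hb hab haS hbS hc

namespace IsWeakPolarSpace

variable (hG : G.IsWeakPolarSpace)
include hG

theorem isSubspace_perp (A : Set P) : G.IsSubspace (G.perp A) :=
  fun L hL x hx y hy hxy hxA hyA z hz a ha =>
    (hG.line_perp L hL a x hx y hy hxy (hxA a ha).symm (hyA a ha).symm z hz).symm

theorem isSingular_iff {S : Set P} : G.IsSingular S ↔ G.IsSubspace S ∧ S ⊆ G.perp S := by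
  refine and_congr_right fun _ => ⟨fun h x hx y hy => ?_, fun h x hx y hy _ => h hx y hy⟩
  by_cases hxy : x = y
  · exact hxy ▸ hG.refl x
  · exact h x hx y hy hxy

theorem subset_perp {S : Set P} (hS : G.IsSingular S) : S ⊆ G.perp S :=
  (hG.isSingular_iff.1 hS).2

theorem span_subset_perp_span {A B : Set P} (h : A ⊆ G.perp B) : G.span A ⊆ G.perp (G.span B) := by
  have h1 : G.span A ⊆ G.perp B := span_subset (hG.isSubspace_perp B) h
  exact subset_perp_comm.1 (span_subset (hG.isSubspace_perp _) (subset_perp_comm.1 h1))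

theorem isSingular_span {A : Set P} (h : A ⊆ G.perp A) : G.IsSingular (G.span A) :=
  hG.isSingular_iff.2 ⟨isSubspace_span A, hG.span_subset_perp_span h⟩

theorem insert_subset_perp {T : Set P} {p : P} (hT : G.IsSingular T) (hp : p ∈ G.perp T) :
    insert p T ⊆ G.perp (insert p T) := by
  rintro x (rfl | hx) y (rfl | hy)
  · exact hG.refl _
  · exact hp y hy
  · exact (hp x hx).symm
  · exact hG.subset_perp hT hx y hy

theorem isSingular_span_insert {T : Set P} {p : P} (hT : G.IsSingular T) (hp : p ∈ G.perp T) :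
    G.IsSingular (G.span (insert p T)) :=
  hG.isSingular_span (hG.insert_subset_perp hT hp)

theorem isSingular_span_union {X Y : Set P} (hX : G.IsSingular X) (hY : G.IsSingular Y)
    (h : X ⊆ G.perp Y) : G.IsSingular (G.span (X ∪ Y)) := by
  refine hG.isSingular_span ?_
  rintro x (hx | hx) y (hy | hy)
  · exact hG.subset_perp hX hx y hy
  · exact h hx y hy
  · exact (h hy x hx).symm
  · exact hG.subset_perp hY hx y hy

theorem isSingular_inter_perp {S : Set P} (hS : G.IsSingular S) (A : Set P) :
    G.IsSingular (S ∩ G.perp A) :=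
  hS.subset_of_inter (hG.isSubspace_perp A)

/-- On the line through collinear points `a` and `b`, where `x` is not collinear to `a`, there is
a point other than `a` collinear to `x`. -/
theorem exists_line_point {a b x : P} (hab : G.Collinear a b) (hxa : ¬ G.Collinear x a) :
    ∃ L ∈ G.lines, a ∈ L ∧ b ∈ L ∧ ∃ c ∈ L, c ≠ a ∧ G.Collinear x c := by
  obtain ⟨L, hL, ha, hb⟩ := hab
  obtain ⟨c, hc, hxc⟩ := hG.exists_perp x L hL ⟨a, ha⟩
  exact ⟨L, hL, ha, hb, c, hc, fun h => hxa (h ▸ hxc), hxc⟩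

theorem wellFoundedLT : WellFoundedLT {T : Set P // G.IsSingular T} := by
  refine ⟨RelEmbedding.wellFounded_iff_isEmpty.2 ⟨fun e => ?_⟩⟩
  have hinj : Function.Injective fun i : ℕ => (e i).1 :=
    Subtype.val_injective.comp e.injective
  refine Set.infinite_range_of_injective hinj (hG.finite_chains _ ?_ ?_)
  · rintro _ ⟨i, rfl⟩
    exact (e i).2
  · rintro _ ⟨i, rfl⟩ _ ⟨j, rfl⟩ hij
    rcases lt_trichotomy i j with h | h | h
    · exact Or.inr (e.map_rel_iff.2 h).le
    · exact absurd (by rw [h]) hij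
    · exact Or.inl (e.map_rel_iff.2 h).le

/-- A singular subspace coincides with its double perp. -/
theorem exists_mem_perp_not_collinear {T : Set P} (hT : G.IsSingular T) {w : P} (hw : w ∉ T) :
    ∃ z ∈ G.perp T, ¬ G.Collinear z w := by
  have key : ∀ T : {T : Set P // G.IsSingular T}, ∀ w ∉ T.1,
      ∃ z ∈ G.perp T.1, ¬ G.Collinear z w := by
    intro T
    refine hG.wellFoundedLT.wf.induction (C := fun T => ∀ w ∉ T.1,
      ∃ z ∈ G.perp T.1, ¬ G.Collinear z w) T ?_
    clear T w hw hT
    rintro ⟨T, hT⟩ ih w hw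
    by_contra! hcon
    simp only at hw hcon
    have hwT : ∀ t ∈ T, G.Collinear t w := fun t ht => hcon t (hG.subset_perp hT ht)
    obtain ⟨y, hy⟩ := hG.no_radical w
    have hyw : ¬ G.Collinear y w := fun h => hy h.symm
    obtain ⟨t, htT, hyt⟩ : ∃ t ∈ T, ¬ G.Collinear y t := by
      by_contra! h
      exact hyw (hcon y h)
    have hwt : w ≠ t := fun h => hw (h ▸ htT)
    -- T' omits t, so the induction hypothesis applies to it and gives u ⊥ T' not collinear to v.
    -- Passing from u to s on the line vy, and then to r on the line su, reaches a point collinear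
    -- to T' and t, hence to w and v. This forces u to be collinear to v.
    set T' := T ∩ G.perp {y} with hT'
    have hT's : G.IsSingular T' := hG.isSingular_inter_perp hT _
    have hyT' : y ∈ G.perp T' := fun a ha => (ha.2 y rfl).symm
    -- a point collinear to `T'` and `t` is collinear to `T`
    have hgen : ∀ r ∈ G.perp T', G.Collinear r t → G.Collinear r w := by
      intro r hr hrt
      refine hcon r fun s hs => ?_
      by_cases hst : s = t
      · exact hst ▸ hrt
      obtain ⟨L, hL, htL, hsL, c, hcL, hct, hyc⟩ :=
        hG.exists_line_point (hG.subset_perp hT htT s hs) hyt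
      have hcT : c ∈ T := mem_of_line hT.1 hL hsL htL hcL hst hs htT
      exact hG.line_perp L hL r c hcL t htL hct
        (hr c ⟨hcT, by rintro _ rfl; exact hyc.symm⟩) hrt s hsL
    obtain ⟨L, hL, htL, hwL, v, hvL, hvt, hyv⟩ := hG.exists_line_point (hwT t htT) hyt
    have hvT : v ∉ T := fun h => hw (mem_of_line hT.1 hL htL hvL hwL hvt.symm htT h)
    obtain ⟨u, huT', huv⟩ := ih ⟨T', hT's⟩
      (lt_of_le_of_ne (fun x hx => hx.1) (fun h => by
        have h1 : t ∈ T' := by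
          have := congrArg Subtype.val h
          simp only at this
          rw [this]; exact htT
        exact hyt (h1.2 y rfl).symm)) v (fun h => hvT h.1)
    have hvperp : ∀ x ∈ T', G.Collinear x v := fun x hx =>
      hG.line_perp L hL x t htL w hwL hwt.symm (hG.subset_perp hT hx.1 t htT) (hwT x hx.1) v hvL
    obtain ⟨M, hM, hvM, hyM, s, hsM, hsv, hus⟩ := hG.exists_line_point hyv.symm huv
    have hvy : v ≠ y := by
      rintro rfl
      exact hyt (hG.line_perp L hL v v hvL w hwL (fun h => by
        subst h
        exact hyw (hG.refl _)) (hG.refl v) ⟨L, hL, hvL, hwL⟩ t htL)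
    have hsT' : s ∈ G.perp T' := fun x hx => (hG.line_perp M hM x v hvM y hyM hvy
      (hvperp x hx) (hyT' x hx).symm s hsM).symm
    have hvt' : G.Collinear t v := ⟨L, hL, htL, hvL⟩
    have hst : ¬ G.Collinear t s := fun h => hyt
      (hG.line_perp M hM t s hsM v hvM hsv h hvt' y hyM).symm
    obtain ⟨N, hN, hsN, huN, r, hrN, hrs, htr⟩ := hG.exists_line_point hus.symm hst
    have hsu : s ≠ u := by
      rintro rfl
      exact huv ⟨M, hM, hsM, hvM⟩
    have hrT' : r ∈ G.perp T' := fun x hx => (hG.line_perp N hN x s hsN u huN hsu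
      (hsT' x hx).symm (huT' x hx).symm r hrN).symm
    have hrv : G.Collinear r v :=
      hG.line_perp L hL r t htL w hwL hwt.symm htr.symm (hgen r hrT' htr.symm) v hvL
    exact huv (hG.line_perp N hN v r hrN s hsN hrs hrv.symm ⟨M, hM, hvM, hsM⟩ u huN).symm
  exact key ⟨T, hT⟩ w hw

/-- If `z` is collinear to all points of `T`, but not to `p`, then the points of `⟨T, p⟩` collinear
to `z` are precisely the points of `T`. -/
theorem mem_of_mem_span_insert {T : Set P} (hT : G.IsSingular T) {p z q : P} (hp : p ∈ G.perp T)
    (hz : z ∈ G.perp T) (hzp : ¬ G.Collinear z p) (hq : q ∈ G.span (insert p T))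
    (hzq : G.Collinear z q) : q ∈ T := by
  by_contra hqT
  have hS := hG.isSingular_span_insert hT hp
  have hpS : p ∈ G.span (insert p T) := subset_span _ (Or.inl rfl)
  have hpq : G.Collinear p q := hG.subset_perp hS hpS q hq
  have hqT' : q ∈ G.perp T := fun t ht => hG.subset_perp hS hq t (subset_span _ (Or.inr ht))
  have hclosed : ∀ y ∈ G.perp T, G.Collinear y p → G.Collinear y q := by
    intro y hy hyp
    have : insert p T ⊆ G.perp {y} := by
      rintro x (rfl | hx) _ rfl
      · exact hyp.symm
      · exact (hy x hx).symm
    exact (span_subset (hG.isSubspace_perp _) this hq y rfl).symm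
  -- Replacing z by a point z₁ of the line qz makes it collinear to z' as well. Some c ≠ z₁ on the
  -- line z₁z' is collinear to p, hence to q by `hclosed`, and then z' is collinear to q.
  obtain ⟨z', hz', hz'q⟩ := hG.exists_mem_perp_not_collinear hT hqT
  have hz'p : ¬ G.Collinear z' p := fun h => hz'q (hclosed z' hz' h)
  obtain ⟨z₁, hz₁, hz₁p, hz₁q, hz₁z'⟩ : ∃ z₁ ∈ G.perp T, ¬ G.Collinear z₁ p ∧
      G.Collinear z₁ q ∧ G.Collinear z' z₁ := by
    obtain ⟨L, hL, hqL, hzL, z₁, hz₁L, hne, hc⟩ := hG.exists_line_point hzq.symm hz'q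
    have hqz : q ≠ z := by
      rintro rfl
      exact hzp hpq.symm
    refine ⟨z₁, fun t ht => (hG.line_perp L hL t q hqL z hzL hqz
      (hqT' t ht).symm (hz t ht).symm z₁ hz₁L).symm, fun h => hzp ?_, ⟨L, hL, hz₁L, hqL⟩, hc⟩
    exact (hG.line_perp L hL p z₁ hz₁L q hqL hne h.symm hpq z hzL).symm
  obtain ⟨L, hL, hz₁L, hz'L, c, hcL, hne, hpc⟩ :=
    hG.exists_line_point hz₁z'.symm (fun h => hz₁p h.symm)
  have hz₁z : z₁ ≠ z' := by
    rintro rfl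
    exact hz'q hz₁q
  have hcT : c ∈ G.perp T := fun t ht => (hG.line_perp L hL t z₁ hz₁L z' hz'L hz₁z
      (hz₁ t ht).symm (hz' t ht).symm c hcL).symm
  exact hz'q (hG.line_perp L hL q c hcL z₁ hz₁L hne (hclosed c hcT hpc.symm).symm
    hz₁q.symm z' hz'L).symm

/-- The line joining p to any point of S carries a second point in z^⊥, so it lies in R. Thus S ∩
z^⊥ is a maximal proper subspace of S. -/
theorem eq_of_inter_perp_subset {S R : Set P} {z : P} (hS : G.IsSingular S)
    (hR : G.IsSubspace R) (hRS : R ⊆ S) (h : S ∩ G.perp {z} ⊆ R) {p : P} (hp : p ∈ R)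
    (hzp : ¬ G.Collinear z p) : R = S := by
  refine hRS.antisymm fun s hs => ?_
  by_cases hsp : s = p
  · exact hsp ▸ hp
  obtain ⟨L, hL, hpL, hsL, c, hcL, hne, hzc⟩ :=
    hG.exists_line_point (hG.subset_perp hS (hRS hp) s hs) hzp
  have hcS : c ∈ S := mem_of_line hS.1 hL hsL hpL hcL hsp hs (hRS hp)
  exact mem_of_line hR hL hcL hpL hsL hne (h ⟨hcS, by rintro _ rfl; exact hzc.symm⟩) hp

end IsWeakPolarSpace

end PointLineGeometry

/-! ### Dimension of singular subspaces. -/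

namespace PointLineGeometry

variable {P : Type*} {G : PointLineGeometry P}

open Classical in
/-- The dimension of a singular subspace. -/
noncomputable def dim (G : PointLineGeometry P) (S : Set P) : ℤ :=
  if h : G.IsSingular S then
    ((Order.height (⟨S, h⟩ : {T : Set P // G.IsSingular T})).toNat : ℤ) - 1 else -1

theorem dim_eq {S : Set P} (hS : G.IsSingular S) : G.dim S =
    ((Order.height (⟨S, hS⟩ : {T : Set P // G.IsSingular T})).toNat : ℤ) - 1 :=
  dif_pos hS

theorem neg_one_le_dim (S : Set P) : -1 ≤ G.dim S := by
  rw [dim]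
  split_ifs <;> omega

theorem isSingular_singleton (p : P) : G.IsSingular {p} :=
  ⟨fun _ _ _ _ _ _ hxy hx hy => absurd (hx.trans hy.symm) hxy,
    fun _ hx _ hy hxy => absurd (hx.trans hy.symm) hxy⟩

theorem dim_empty : G.dim (∅ : Set P) = -1 := by
  rw [dim_eq isSingular_empty, Order.height_eq_zero.2 fun T _ => Set.empty_subset T.1]
  simp

namespace IsWeakPolarSpace

variable (hG : G.IsWeakPolarSpace)
include hG

theorem covBy_of_inter_perp {S : Set P} (hS : G.IsSingular S) {z s : P} (hs : s ∈ S)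
    (hzs : ¬ G.Collinear z s) :
    (⟨S ∩ G.perp {z}, hG.isSingular_inter_perp hS _⟩ : {T : Set P // G.IsSingular T}) ⋖ ⟨S, hS⟩ := by
  refine ⟨lt_of_le_of_ne (fun x hx => hx.1) fun h => ?_, ?_⟩
  · have h1 : s ∈ S ∩ G.perp {z} := by
      have := congrArg Subtype.val h
      simp only at this
      rw [this]
      exact hs
    exact hzs (h1.2 z rfl).symm
  · rintro ⟨R, hR⟩ h1 h2
    have h1' : S ∩ G.perp {z} ⊆ R := h1.le
    have h2' : R ⊆ S := h2.le
    obtain ⟨p, hpR, hp⟩ := Set.exists_of_ssubset (show S ∩ G.perp {z} ⊂ R from h1)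
    have hzp : ¬ G.Collinear z p := fun h => hp ⟨h2' hpR, by rintro _ rfl; exact h.symm⟩
    exact h2.ne (Subtype.ext (hG.eq_of_inter_perp_subset hS hR.1 h2' h1' hpR hzp))

theorem exists_inter_perp_of_lt {S T : Set P} (hT : G.IsSingular T)
    (h : T ⊂ S) : ∃ z, ∃ s ∈ S, ¬ G.Collinear z s ∧ s ∉ T ∧ z ∈ G.perp T ∧ T ⊆ S ∩ G.perp {z} := by
  obtain ⟨s, hs, hsT⟩ := Set.exists_of_ssubset h
  obtain ⟨z, hz, hzs⟩ := hG.exists_mem_perp_not_collinear hT hsT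
  exact ⟨z, s, hs, hzs, hsT, hz, fun t ht => ⟨h.1 ht, by rintro _ rfl; exact (hz t ht).symm⟩⟩

theorem exists_covBy_of_lt {T S : {T : Set P // G.IsSingular T}} (h : T < S) :
    ∃ R, T ≤ R ∧ R ⋖ S := by
  obtain ⟨z, s, hs, hzs, -, -, hT⟩ := hG.exists_inter_perp_of_lt T.2 h
  exact ⟨_, hT, hG.covBy_of_inter_perp S.2 hs hzs⟩

/-- The lower cover T₂ equals S ∩ z^⊥ for some z, so T₁ ∩ T₂ = T₁ ∩ z^⊥ is a hyperplane of T₁. -/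
theorem inter_covBy {S T₁ T₂ : {T : Set P // G.IsSingular T}} (h₁ : T₁ ⋖ S) (h₂ : T₂ ⋖ S)
    (hne : T₁ ≠ T₂) :
    (⟨T₁.1 ∩ T₂.1, T₁.2.subset_of_inter T₂.2.1⟩ : {T : Set P // G.IsSingular T}) ⋖ T₁ := by
  obtain ⟨z, s, hs, hzs, -, -, hT⟩ := hG.exists_inter_perp_of_lt T₂.2 h₂.lt
  have hT₂ : T₂ = ⟨S.1 ∩ G.perp {z}, hG.isSingular_inter_perp S.2 _⟩ := by
    by_contra hne'
    exact h₂.2 (lt_of_le_of_ne hT hne') (hG.covBy_of_inter_perp S.2 hs hzs).lt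
  have hnot : ¬ T₁ ≤ T₂ := fun h => h₁.2 (lt_of_le_of_ne h hne) h₂.lt
  obtain ⟨t, ht₁, ht₂⟩ := Set.not_subset.1 (show ¬ T₁.1 ⊆ T₂.1 from hnot)
  have hTS : T₁.1 ⊆ S.1 := h₁.le
  have hzt : ¬ G.Collinear z t := fun h => ht₂ (by
    rw [hT₂]
    exact ⟨hTS ht₁, by rintro _ rfl; exact h.symm⟩)
  convert hG.covBy_of_inter_perp T₁.2 ht₁ hzt using 2
  rw [hT₂]
  ext x
  exact ⟨fun h => ⟨h.1, h.2.2⟩, fun h => ⟨h.1, hTS h.1, h.2⟩⟩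

/-- A Jordan–Dedekind argument: two lower covers of S both cover their intersection, so by induction
they have equal height. -/
theorem height_covBy (S : {T : Set P // G.IsSingular T}) :
    Order.height S ≠ ⊤ ∧ ∀ T, T ⋖ S → Order.height S = Order.height T + 1 := by
  refine hG.wellFoundedLT.wf.induction (C := fun S => Order.height S ≠ ⊤ ∧
    ∀ T, T ⋖ S → Order.height S = Order.height T + 1) S ?_
  clear S
  intro S ih
  have hcov : ∀ T, T ⋖ S → Order.height S = Order.height T + 1 := by
    intro T₁ h₁
    refine le_antisymm ?_ (Order.height_add_one_le h₁.lt)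
    rw [Order.height_eq_iSup_lt_height]
    refine iSup₂_le fun T hT => ?_
    obtain ⟨T₂, hTT₂, h₂⟩ := hG.exists_covBy_of_lt hT
    refine add_le_add_left ((Order.height_mono hTT₂).trans ?_) 1
    by_cases hne : T₁ = T₂
    · rw [hne]
    · rw [(ih T₁ h₁.lt).2 _ (hG.inter_covBy h₁ h₂ hne),
        (ih T₂ h₂.lt).2 _ (hG.inter_covBy h₂ h₁ (Ne.symm hne))]
      simp only [Set.inter_comm, le_refl]
  refine ⟨?_, hcov⟩
  by_cases hmin : IsMin S
  · rw [Order.height_eq_zero.2 hmin]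
    simp
  · obtain ⟨T, hT⟩ := not_isMin_iff.1 hmin
    obtain ⟨R, -, hR⟩ := hG.exists_covBy_of_lt hT
    rw [hcov R hR]
    simpa using (ih R hR.lt).1

theorem hasDim_iff {S : Set P} {d : ℤ} : G.HasDim S d ↔ G.IsSingular S ∧ G.dim S = d := by
  constructor
  · rintro ⟨h, m, hm, rfl⟩
    refine ⟨h, ?_⟩
    rw [dim_eq h, hm, ENat.toNat_natCast]
  · rintro ⟨h, rfl⟩
    refine ⟨h, (Order.height (⟨S, h⟩ : {T : Set P // G.IsSingular T})).toNat,
      (ENat.natCast_toNat (hG.height_covBy _).1).symm, ?_⟩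
    rw [dim_eq h]

theorem dim_covBy {S T : {T : Set P // G.IsSingular T}} (h : T ⋖ S) :
    G.dim S.1 = G.dim T.1 + 1 := by
  rw [dim_eq S.2, dim_eq T.2, (hG.height_covBy S).2 T h,
    ENat.toNat_add (hG.height_covBy T).1 (by simp)]
  simp

theorem dim_lt_of_ssubset {S T : Set P} (hS : G.IsSingular S) (hT : G.IsSingular T) (h : T ⊂ S) :
    G.dim T < G.dim S := by
  rw [dim_eq hS, dim_eq hT]
  have h1 : Order.height (⟨T, hT⟩ : {T : Set P // G.IsSingular T}) <
      Order.height (⟨S, hS⟩ : {T : Set P // G.IsSingular T}) :=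
    Order.height_strictMono h (lt_top_iff_ne_top.2 (hG.height_covBy _).1)
  rw [← ENat.natCast_toNat (hG.height_covBy ⟨T, hT⟩).1,
    ← ENat.natCast_toNat (hG.height_covBy ⟨S, hS⟩).1, Nat.cast_lt] at h1
  omega

theorem dim_mono {S T : Set P} (hS : G.IsSingular S) (hT : G.IsSingular T) (h : T ⊆ S) :
    G.dim T ≤ G.dim S := by
  rcases h.eq_or_ssubset with rfl | h
  · exact le_rfl
  · exact (hG.dim_lt_of_ssubset hS hT h).le

theorem eq_of_subset_of_dim_le {S T : Set P} (hS : G.IsSingular S) (hT : G.IsSingular T)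
    (h : T ⊆ S) (hd : G.dim S ≤ G.dim T) : T = S := by
  rcases h.eq_or_ssubset with rfl | h
  · rfl
  · exact absurd (hG.dim_lt_of_ssubset hS hT h) (not_lt.2 hd)

theorem dim_inter_perp_singleton {S : Set P} (hS : G.IsSingular S) {z s : P} (hs : s ∈ S)
    (hzs : ¬ G.Collinear z s) : G.dim (S ∩ G.perp {z}) = G.dim S - 1 := by
  have := hG.dim_covBy (hG.covBy_of_inter_perp hS hs hzs)
  simp only at this
  omega

theorem le_dim_inter_perp_singleton {S : Set P} (hS : G.IsSingular S) (z : P) :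
    G.dim S - 1 ≤ G.dim (S ∩ G.perp {z}) := by
  by_cases h : ∃ s ∈ S, ¬ G.Collinear z s
  · obtain ⟨s, hs, hzs⟩ := h
    rw [hG.dim_inter_perp_singleton hS hs hzs]
  · push Not at h
    rw [Set.inter_eq_left.2 fun s hs => by rintro _ rfl; exact (h s hs).symm]
    omega

theorem exists_hyperplane {S T : Set P} (hS : G.IsSingular S) (hT : G.IsSingular T) (h : T ⊂ S) :
    ∃ R, G.IsSingular R ∧ T ⊆ R ∧ R ⊆ S ∧ G.dim R = G.dim S - 1 := by
  obtain ⟨z, s, hs, hzs, -, -, hTz⟩ := hG.exists_inter_perp_of_lt hT h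
  exact ⟨_, hG.isSingular_inter_perp hS _, hTz, Set.inter_subset_left,
    hG.dim_inter_perp_singleton hS hs hzs⟩

theorem span_insert_inter_perp {T : Set P} (hT : G.IsSingular T) {p z : P} (hp : p ∈ G.perp T)
    (hz : z ∈ G.perp T) (hzp : ¬ G.Collinear z p) : G.span (insert p T) ∩ G.perp {z} = T := by
  refine Set.Subset.antisymm (fun q hq => hG.mem_of_mem_span_insert hT hp hz hzp hq.1
    (hq.2 z rfl).symm) fun t ht => ⟨subset_span _ (Or.inr ht), ?_⟩
  rintro _ rfl
  exact (hz t ht).symm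

/-- A point z ⊥ T not collinear to p cuts ⟨p,T⟩ in exactly T, so T is a hyperplane. This takes the
place of an exchange axiom. -/
theorem dim_span_insert {T : Set P} (hT : G.IsSingular T) {p : P} (hp : p ∈ G.perp T)
    (hpT : p ∉ T) : G.dim (G.span (insert p T)) = G.dim T + 1 := by
  obtain ⟨z, hz, hzp⟩ := hG.exists_mem_perp_not_collinear hT hpT
  have := hG.dim_inter_perp_singleton (hG.isSingular_span_insert hT hp)
    (subset_span _ (Or.inl rfl)) hzp
  rw [hG.span_insert_inter_perp hT hp hz hzp] at this
  omega

theorem dim_span_insert_le {T : Set P} (hT : G.IsSingular T) {p : P} (hp : p ∈ G.perp T) :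
    G.dim (G.span (insert p T)) ≤ G.dim T + 1 := by
  by_cases hpT : p ∈ T
  · rw [Set.insert_eq_of_mem hpT, hT.1.span_eq]
    omega
  · exact (hG.dim_span_insert hT hp hpT).le

theorem dim_singleton (p : P) : G.dim {p} = 0 := by
  have h := hG.dim_span_insert (isSingular_empty (G := G)) (p := p) (fun _ h => h.elim) (by simp)
  rw [dim_empty, insert_empty_eq, (isSingular_singleton p).1.span_eq] at h
  omega

theorem exists_between {S T : Set P} (hS : G.IsSingular S) (hT : G.IsSingular T) (h : T ⊆ S)
    {d : ℤ} (hd : G.dim T ≤ d) (hd' : d ≤ G.dim S) :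
    ∃ R, G.IsSingular R ∧ T ⊆ R ∧ R ⊆ S ∧ G.dim R = d := by
  obtain ⟨m, hm⟩ := Int.eq_ofNat_of_zero_le (sub_nonneg.2 hd')
  induction m generalizing S with
  | zero => exact ⟨S, hS, h, subset_rfl, by simp at hm; omega⟩
  | succ m ih =>
    have hne : T ≠ S := by
      rintro rfl
      push_cast at hm
      omega
    obtain ⟨R, hR, hTR, hRS, hdR⟩ := hG.exists_hyperplane hS hT (h.ssubset_of_ne hne)
    push_cast at hm
    obtain ⟨R', hR', h1, h2, h3⟩ := ih hR hTR (by omega) (by omega)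
    exact ⟨R', hR', h1, h2.trans hRS, h3⟩

/-- A singular subspace is spanned by a hyperplane and a point outside of it. -/
theorem eq_span_insert {S T : Set P} (hS : G.IsSingular S) (hT : G.IsSingular T) (h : T ⊆ S)
    (hd : G.dim S ≤ G.dim T + 1) {p : P} (hp : p ∈ S) (hpT : p ∉ T) :
    S = G.span (insert p T) := by
  have hp' : p ∈ G.perp T := fun t ht => hG.subset_perp hS hp t (h ht)
  refine (hG.eq_of_subset_of_dim_le hS (hG.isSingular_span_insert hT hp')
    (span_subset hS.1 (Set.insert_subset hp h)) ?_).symm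
  rw [hG.dim_span_insert hT hp' hpT]
  exact hd

/-- A proper H has the form S ∩ z^⊥, and intersecting with z^⊥ costs R at most one dimension. -/
theorem dim_inter_of_hyperplane {S H R : Set P} (hS : G.IsSingular S) (hH : G.IsSingular H)
    (hR : G.IsSingular R) (hHS : H ⊆ S) (hRS : R ⊆ S) (hd : G.dim S ≤ G.dim H + 1) :
    G.dim R - 1 ≤ G.dim (R ∩ H) := by
  rcases hHS.eq_or_ssubset with rfl | h
  · rw [Set.inter_eq_left.2 hRS]
    omega
  obtain ⟨z, s, hs, hzs, -, -, hHz⟩ := hG.exists_inter_perp_of_lt hH h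
  have h1 := hG.dim_inter_perp_singleton hS hs hzs
  have h2 := hG.eq_of_subset_of_dim_le (hG.isSingular_inter_perp hS {z}) hH hHz (by omega)
  have h3 : R ∩ H = R ∩ G.perp {z} := by
    rw [h2]
    ext x
    exact ⟨fun h => ⟨h.1, h.2.2⟩, fun h => ⟨h.1, hRS h.1, h.2⟩⟩
  rw [h3]
  exact hG.le_dim_inter_perp_singleton hR z

/-- N is already perpendicular to A. Each point adjoined on the way from A up to S costs at most one
dimension. -/
theorem le_dim_inter_perp {A S N : Set P} (hA : G.IsSingular A) (hS : G.IsSingular S)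
    (hN : G.IsSingular N) (hAS : A ⊆ S) (hAN : A ⊆ N) :
    G.dim N - (G.dim S - G.dim A) ≤ G.dim (N ∩ G.perp S) := by
  obtain ⟨m, hm⟩ := Int.eq_ofNat_of_zero_le (sub_nonneg.2 (hG.dim_mono hS hA hAS))
  induction m generalizing S with
  | zero =>
    rw [← hG.eq_of_subset_of_dim_le hS hA hAS (by simp at hm; omega),
      Set.inter_eq_left.2 ((hG.subset_perp hN).trans (perp_anti hAN))]
    omega
  | succ m ih =>
    push_cast at hm
    have hne : A ≠ S := by
      rintro rfl
      omega
    obtain ⟨R, hR, hTR, hRS, hdR⟩ := hG.exists_hyperplane hS hA (hAS.ssubset_of_ne hne)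
    have h1 := ih hR hTR (by omega)
    have hRS' : R ⊂ S := hRS.ssubset_of_ne (by rintro rfl; omega)
    obtain ⟨p, hp, hpR⟩ := Set.exists_of_ssubset hRS'
    have h2 := hG.le_dim_inter_perp_singleton (hG.isSingular_inter_perp hN R) p
    refine le_trans (by omega) (h2.trans (hG.dim_mono (hG.isSingular_inter_perp hN _)
      (hG.isSingular_inter_perp (hG.isSingular_inter_perp hN _) _) ?_))
    rintro x ⟨⟨hxN, hxR⟩, hxp⟩
    refine ⟨hxN, ?_⟩
    have h3 : insert p R ⊆ G.perp {x} := by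
      rintro y (rfl | hy) _ rfl
      · exact (hxp y rfl).symm
      · exact (hxR y hy).symm
    have h4 := span_subset (hG.isSubspace_perp {x}) h3
    rw [← hG.eq_span_insert hS hR hRS (by omega) hp hpR] at h4
    exact subset_perp_comm.1 h4 rfl

variable {n : ℕ} (hn : G.HasRank n)
include hn

theorem dim_le {S : Set P} (hS : G.IsSingular S) : G.dim S ≤ n - 1 :=
  hn.2 ⟨S, hG.hasDim_iff.2 ⟨hS, rfl⟩⟩

/-- If dim S < n - 1, take N of dimension n - 1. By `le_dim_inter_perp`, N ∩ S^⊥ is larger than N ∩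
S, so N contains a point by which S can be enlarged. -/
theorem exists_maximal {S : Set P} (hS : G.IsSingular S) :
    ∃ U, G.IsSingular U ∧ S ⊆ U ∧ G.dim U = n - 1 := by
  obtain ⟨N, hN⟩ := hn.1
  obtain ⟨hN, hdN⟩ := hG.hasDim_iff.1 hN
  obtain ⟨m, hm⟩ := Int.eq_ofNat_of_zero_le (sub_nonneg.2 (hG.dim_le hn hS))
  induction m generalizing S with
  | zero => exact ⟨S, hS, subset_rfl, by simp at hm; omega⟩
  | succ m ih =>
    push_cast at hm
    have hI := hN.subset_of_inter hS.1
    have h1 := hG.le_dim_inter_perp hI hS hN Set.inter_subset_right Set.inter_subset_left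
    obtain ⟨p, ⟨hpN, hpS⟩, hp⟩ : ∃ p ∈ N ∩ G.perp S, p ∉ S := by
      by_contra! h
      have := hG.dim_mono hI (hG.isSingular_inter_perp hN S) fun x hx => ⟨hx.1, h x hx⟩
      omega
    have h2 := hG.dim_span_insert hS hpS hp
    obtain ⟨U, hU, hSU, hdU⟩ := ih (hG.isSingular_span_insert hS hpS) (by omega)
    exact ⟨U, hU, ((Set.subset_insert _ _).trans (subset_span _)).trans hSU, hdU⟩

end IsWeakPolarSpace

end PointLineGeometry

/-! ### Joins and intersections of subspaces over a common hyperplane. -/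

namespace PointLineGeometry

variable {P : Type*} {G : PointLineGeometry P}

namespace IsWeakPolarSpace

variable (hG : G.IsWeakPolarSpace)
include hG

theorem mem_perp_span_insert {A : Set P} {x p : P} (hxA : x ∈ G.perp A) (hxp : G.Collinear x p) :
    x ∈ G.perp (G.span (insert p A)) := by
  have h : {x} ⊆ G.perp (insert p A) := by
    rintro _ rfl y (rfl | hy)
    · exact hxp
    · exact hxA y hy
  exact hG.span_subset_perp_span h (subset_span _ rfl)

theorem exists_join {A X Y : Set P} (hA : G.IsSingular A) (hX : G.IsSingular X)
    (hY : G.IsSingular Y) (hAX : A ⊆ X) (hAY : A ⊆ Y) (hXY : X ⊆ G.perp Y) (hne : X ≠ Y)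
    (hdX : G.dim X = G.dim A + 1) (hdY : G.dim Y = G.dim A + 1) :
    ∃ y ∈ Y, y ∉ X ∧ y ∈ G.perp X ∧ Y = G.span (insert y A) ∧
      G.span (X ∪ Y) = G.span (insert y X) ∧ G.dim (G.span (X ∪ Y)) = G.dim X + 1 := by
  obtain ⟨y, hyY, hyX⟩ : ∃ y ∈ Y, y ∉ X := by
    by_contra! h
    exact hne (hG.eq_of_subset_of_dim_le hX hY h (by omega)).symm
  have hyA : y ∉ A := fun h => hyX (hAX h)
  have hyp : y ∈ G.perp X := subset_perp_comm.1 hXY hyY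
  have h1 := hG.eq_span_insert hY hA hAY hdY.le hyY hyA
  have h2 : G.span (X ∪ Y) = G.span (insert y X) := by
    refine (span_subset (isSubspace_span _) (Set.union_subset ?_ ?_)).antisymm
      (span_mono (Set.insert_subset (Or.inr hyY) Set.subset_union_left))
    · exact (Set.subset_insert _ _).trans (subset_span _)
    · rw [h1]
      exact span_mono (Set.insert_subset_insert hAX)
  exact ⟨y, hyY, hyX, hyp, h1, h2, by rw [h2, hG.dim_span_insert hX hyp hyX]⟩

theorem inter_eq_of_ne {A X Y : Set P} (hA : G.IsSingular A) (hX : G.IsSingular X)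
    (hY : G.IsSingular Y) (hAX : A ⊆ X) (hAY : A ⊆ Y) (hne : X ≠ Y)
    (hdX : G.dim X = G.dim A + 1) (hdY : G.dim Y = G.dim A + 1) : X ∩ Y = A := by
  have hI := hX.subset_of_inter hY.1
  refine (hG.eq_of_subset_of_dim_le hI hA (Set.subset_inter hAX hAY) ?_).symm
  by_contra! h
  have h1 := hG.eq_of_subset_of_dim_le hX hI Set.inter_subset_left (by omega)
  have h2 := hG.eq_of_subset_of_dim_le hY hI Set.inter_subset_right (by omega)
  exact hne (h1.symm.trans h2)

/-- The intersection of two distinct hyperplanes of a singular subspace. -/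
theorem dim_inter_of_ne {S X Y : Set P} (hS : G.IsSingular S) (hX : G.IsSingular X)
    (hY : G.IsSingular Y) (hXS : X ⊆ S) (hYS : Y ⊆ S) (hne : X ≠ Y)
    (hdX : G.dim S = G.dim X + 1) (hdY : G.dim S = G.dim Y + 1) :
    G.dim (X ∩ Y) = G.dim X - 1 := by
  have h1 := hG.dim_inter_of_hyperplane hS hY hX hYS hXS hdY.le
  have hI := hX.subset_of_inter hY.1
  by_contra! h
  have h1 := hG.eq_of_subset_of_dim_le hX hI Set.inter_subset_left (by omega)
  have h2 := hG.eq_of_subset_of_dim_le hY hI Set.inter_subset_right (by omega)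
  exact hne (h1.symm.trans h2)

/-! ### Subspaces in opposite position over a common part. -/

section Opposite

variable {n : ℕ} (hn : G.HasRank n)
include hn

/-- X₁ and X₂ are enlarged by non-collinear points u and v, both perpendicular to X₁ and X₂. Then v
cuts ⟨u,X₁⟩ down to X₁, and u cuts ⟨v,X₂⟩ down to X₂. -/
theorem exists_extend_opposite {B X₁ X₂ : Set P} {i : ℤ} (hB : G.IsSingular B)
    (h₁ : G.IsSingular X₁) (h₂ : G.IsSingular X₂) (hB₁ : B ⊆ X₁) (hB₂ : B ⊆ X₂)
    (hd₁ : G.dim X₁ = i) (hd₂ : G.dim X₂ = i) (h₁₂ : X₁ ∩ G.perp X₂ ⊆ B)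
    (h₂₁ : X₂ ∩ G.perp X₁ ⊆ B) (hi : i < n - 1) :
    ∃ Y₁ Y₂, G.IsSingular Y₁ ∧ G.IsSingular Y₂ ∧ X₁ ⊆ Y₁ ∧ X₂ ⊆ Y₂ ∧ G.dim Y₁ = i + 1 ∧
      G.dim Y₂ = i + 1 ∧ Y₁ ∩ G.perp Y₂ ⊆ B ∧ Y₂ ∩ G.perp Y₁ ⊆ B := by
  obtain ⟨U, hU, hXU, hdU⟩ := hG.exists_maximal hn h₁
  have hB' : ∀ {N : Set P}, G.IsSingular N → B ⊆ N → G.dim B < G.dim (N ∩ G.perp X₂) →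
      ∃ x ∈ N ∩ G.perp X₂, x ∉ B := by
    intro N hN _ hd
    by_contra! h
    exact absurd (hG.dim_mono hB (hG.isSingular_inter_perp hN _) h) (by omega)
  have h3 := hG.le_dim_inter_perp hB h₂ hU hB₂ (hB₁.trans hXU)
  obtain ⟨u, ⟨huU, hu₂⟩, huB⟩ := hB' hU (hB₁.trans hXU) (by omega)
  have hu₁ : u ∈ G.perp X₁ := fun x hx => hG.subset_perp hU huU x (hXU hx)
  have huX₁ : u ∉ X₁ := fun h => huB (h₁₂ ⟨h, hu₂⟩)
  -- v₀ need not be perpendicular to X₂. It is corrected to a point v of ⟨v₀,X₁⟩ ∩ X₂^⊥ outside B,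
  -- still not collinear to u because v ∉ X₁.
  obtain ⟨v₀, hv₀, hv₀u⟩ := hG.exists_mem_perp_not_collinear h₁ huX₁
  have hv₀X : v₀ ∉ X₁ := fun h => hv₀u (hu₁ v₀ h).symm
  have hT := hG.isSingular_span_insert h₁ hv₀
  have hX₁T : X₁ ⊆ G.span (insert v₀ X₁) := (Set.subset_insert _ _).trans (subset_span _)
  have hdT := hG.dim_span_insert h₁ hv₀ hv₀X
  have h4 := hG.le_dim_inter_perp hB h₂ hT hB₂ (hB₁.trans hX₁T)
  obtain ⟨v, ⟨hvT, hv₂⟩, hvB⟩ := hB' hT (hB₁.trans hX₁T) (by omega)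
  have hv₁ : v ∈ G.perp X₁ := fun x hx => hG.subset_perp hT hvT x (hX₁T hx)
  have huv : ¬ G.Collinear u v := fun h =>
    hvB (h₁₂ ⟨hG.mem_of_mem_span_insert h₁ hv₀ hu₁ (fun h => hv₀u h.symm) hvT h, hv₂⟩)
  have hvX₂ : v ∉ X₂ := fun h => hvB (h₂₁ ⟨h, hv₁⟩)
  refine ⟨_, _, hG.isSingular_span_insert h₁ hu₁, hG.isSingular_span_insert h₂ hv₂,
    (Set.subset_insert _ _).trans (subset_span _), (Set.subset_insert _ _).trans (subset_span _),
    by rw [hG.dim_span_insert h₁ hu₁ huX₁, hd₁], by rw [hG.dim_span_insert h₂ hv₂ hvX₂, hd₂],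
    ?_, ?_⟩
  · rintro x ⟨hx, hxp⟩
    exact h₁₂ ⟨hG.mem_of_mem_span_insert h₁ hu₁ hv₁ (fun h => huv h.symm) hx
      (hxp v (subset_span _ (Or.inl rfl))).symm,
      fun y hy => hxp y (subset_span _ (Or.inr hy))⟩
  · rintro x ⟨hx, hxp⟩
    exact h₂₁ ⟨hG.mem_of_mem_span_insert h₂ hv₂ hu₂ huv hx
      (hxp u (subset_span _ (Or.inl rfl))).symm,
      fun y hy => hxp y (subset_span _ (Or.inr hy))⟩

theorem exists_opposite {A₁ A₂ B : Set P} {k : ℤ} (h₁ : G.IsSingular A₁)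
    (h₂ : G.IsSingular A₂) (hB : G.IsSingular B) (hB₁ : B ⊆ A₁) (hB₂ : B ⊆ A₂)
    (hd₁ : G.dim A₁ = G.dim B + 1) (hd₂ : G.dim A₂ = G.dim B + 1) (hperp : A₁ ⊆ G.perp A₂)
    (hne : A₁ ≠ A₂) (hjk : G.dim B + 2 ≤ k) (hkn : k ≤ n - 1) :
    ∃ X₁ X₂, G.IsSingular X₁ ∧ G.IsSingular X₂ ∧ A₁ ⊆ X₁ ∧ A₂ ⊆ X₂ ∧ G.dim X₁ = k ∧
      G.dim X₂ = k ∧ X₁ ∩ G.perp X₂ ⊆ B := by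
  suffices ∀ m : ℕ, G.dim B + 2 + m ≤ n - 1 → ∃ X₁ X₂, G.IsSingular X₁ ∧ G.IsSingular X₂ ∧
      A₁ ⊆ X₁ ∧ A₂ ⊆ X₂ ∧ G.dim X₁ = G.dim B + 2 + m ∧ G.dim X₂ = G.dim B + 2 + m ∧
      X₁ ∩ G.perp X₂ ⊆ B ∧ X₂ ∩ G.perp X₁ ⊆ B by
    obtain ⟨X₁, X₂, s₁, s₂, i₁, i₂, d₁, d₂, h, -⟩ := this (k - (G.dim B + 2)).toNat (by omega)
    exact ⟨X₁, X₂, s₁, s₂, i₁, i₂, by omega, by omega, h⟩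
  intro m
  induction m with
  | zero =>
    intro _
    obtain ⟨a₂, ha₂, ha₂', -⟩ := hG.exists_join hB h₁ h₂ hB₁ hB₂ hperp hne hd₁ hd₂
    obtain ⟨a₁, ha₁, ha₁', -⟩ :=
      hG.exists_join hB h₂ h₁ hB₂ hB₁ (subset_perp_comm.1 hperp) hne.symm hd₂ hd₁
    -- In `key`, collinearity to a₂ cuts ⟨x₁,A₁⟩ down to A₁, and collinearity to x₂ cuts A₁ down to
    -- B.
    obtain ⟨x₁, hx₁, hx₁a⟩ := hG.exists_mem_perp_not_collinear h₁ ha₂'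
    obtain ⟨x₂, hx₂, hx₂a⟩ := hG.exists_mem_perp_not_collinear h₂ ha₁'
    have hx₁A : x₁ ∉ A₁ := fun h => hx₁a (hperp h a₂ ha₂)
    have hx₂A : x₂ ∉ A₂ := fun h => hx₂a (subset_perp_comm.1 hperp h a₁ ha₁)
    have key : ∀ {A₁ A₂ : Set P} {x₁ x₂ a₁ a₂ : P}, G.IsSingular A₁ → G.IsSingular A₂ →
        A₁ ⊆ G.perp A₂ → B ⊆ A₁ → B ⊆ A₂ → G.dim A₁ = G.dim B + 1 → a₁ ∈ A₁ → a₁ ∉ A₂ → a₂ ∈ A₂ →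
        x₁ ∈ G.perp A₁ → ¬ G.Collinear x₁ a₂ → x₂ ∈ G.perp A₂ → ¬ G.Collinear x₂ a₁ →
        G.span (insert x₁ A₁) ∩ G.perp (G.span (insert x₂ A₂)) ⊆ B := by
      rintro A₁ A₂ x₁ x₂ a₁ a₂ h₁ h₂ hperp hB₁ hB₂ hd ha₁ ha₁' ha₂ hx₁ hx₁a hx₂ hx₂a x ⟨hx, hxp⟩
      have hxA : x ∈ A₁ := hG.mem_of_mem_span_insert h₁ hx₁ (subset_perp_comm.1 hperp ha₂)
        (fun h => hx₁a h.symm) hx (hxp a₂ (subset_span _ (Or.inr ha₂))).symm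
      have e := hG.eq_span_insert h₁ hB hB₁ hd.le ha₁ (fun h => ha₁' (hB₂ h))
      rw [e] at hxA
      exact hG.mem_of_mem_span_insert hB (fun b hb => hG.subset_perp h₁ ha₁ b (hB₁ hb))
        (perp_anti hB₂ hx₂) hx₂a hxA (hxp x₂ (subset_span _ (Or.inl rfl))).symm
    refine ⟨_, _, hG.isSingular_span_insert h₁ hx₁, hG.isSingular_span_insert h₂ hx₂,
      (Set.subset_insert _ _).trans (subset_span _), (Set.subset_insert _ _).trans (subset_span _),
      ?_, ?_, key h₁ h₂ hperp hB₁ hB₂ hd₁ ha₁ ha₁' ha₂ hx₁ hx₁a hx₂ hx₂a,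
      key h₂ h₁ (subset_perp_comm.1 hperp) hB₂ hB₁ hd₂ ha₂ ha₂' ha₁ hx₂ hx₂a hx₁ hx₁a⟩
    · rw [hG.dim_span_insert h₁ hx₁ hx₁A]
      push_cast
      omega
    · rw [hG.dim_span_insert h₂ hx₂ hx₂A]
      push_cast
      omega
  | succ m ih =>
    intro hm
    push_cast at hm
    obtain ⟨X₁, X₂, s₁, s₂, i₁, i₂, d₁, d₂, e₁, e₂⟩ := ih (by omega)
    obtain ⟨Y₁, Y₂, t₁, t₂, j₁, j₂, d₁', d₂', e⟩ := hG.exists_extend_opposite hn hB s₁ s₂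
      (hB₁.trans i₁) (hB₂.trans i₂) d₁ d₂ e₁ e₂ (by omega)
    exact ⟨Y₁, Y₂, t₁, t₂, i₁.trans j₁, i₂.trans j₂, by push_cast; omega, by push_cast; omega, e⟩

end Opposite

/-! ### Distance in the Grassmann graph and intersection dimension. -/

section Distance

variable {n k : ℕ}

theorem edist_le_one (hk : k + 1 < n) {X Y : G.Grassmannian k} {N : Set P} (hN : G.IsSingular N)
    (hd : G.dim N = k + 1) (hX : X.1 ⊆ N) (hY : Y.1 ⊆ N) :
    (G.grassmannGraph n k).edist X Y ≤ 1 := by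
  rw [SimpleGraph.edist_le_one_iff_adj_or_eq]
  by_cases h : X = Y
  · exact Or.inr h
  · exact Or.inl ⟨h, Or.inl ⟨hk, N, hG.hasDim_iff.2 ⟨hN, hd⟩, hX, hY⟩⟩

theorem edist_le_of_subset (hk : k + 1 < n) (c : ℕ) {X Y : G.Grassmannian k} {N : Set P}
    (hN : G.IsSingular N) (hd : G.dim N = k + 1) (hX : X.1 ⊆ N)
    (hY : (k : ℤ) - c ≤ G.dim (N ∩ Y.1)) : (G.grassmannGraph n k).edist X Y ≤ c + 1 := by
  obtain ⟨sY, dY⟩ := hG.hasDim_iff.1 Y.2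
  have hI : G.IsSingular (N ∩ Y.1) := hN.subset_of_inter sY.1
  induction c generalizing X N with
  | zero =>
    have h := hG.eq_of_subset_of_dim_le sY hI Set.inter_subset_right (by simp at hY; omega)
    have h' : Y.1 ⊆ N := by
      rw [← h]
      exact Set.inter_subset_left
    simpa using hG.edist_le_one hk hN hd hX h'
  | succ c ih =>
    by_cases hYN : Y.1 ⊆ N
    · refine (hG.edist_le_one hk hN hd hX hYN).trans ?_
      simp
    obtain ⟨y, hy, hyN⟩ := Set.not_subset.1 hYN
    -- The path goes from X to Z inside N. From there N is replaced by ⟨y,Z⟩, whose intersection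
    -- with Y gains the point y.
    obtain ⟨Z, sZ, hZN, hIZ, hyZ, dZ⟩ : ∃ Z, G.IsSingular Z ∧ Z ⊆ N ∧ N ∩ Y.1 ⊆ Z ∧
        y ∈ G.perp Z ∧ G.dim Z = k := by
      by_cases h : ∃ s ∈ N, ¬ G.Collinear y s
      · obtain ⟨s, hs, hys⟩ := h
        refine ⟨_, hG.isSingular_inter_perp hN {y}, Set.inter_subset_left, ?_, ?_, ?_⟩
        · rintro x ⟨hxN, hxY⟩
          refine ⟨hxN, ?_⟩
          rintro _ rfl
          exact hG.subset_perp sY hxY _ hy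
        · exact fun x hx => (hx.2 y rfl).symm
        · rw [hG.dim_inter_perp_singleton hN hs hys]
          omega
      · push Not at h
        have hne : N ∩ Y.1 ⊂ N := by
          refine Set.inter_subset_left.ssubset_of_ne fun e => ?_
          have := hG.dim_mono sY hN (Set.inter_eq_left.1 e)
          omega
        obtain ⟨Z, sZ, h1, h2, h3⟩ := hG.exists_hyperplane hN hI hne
        exact ⟨Z, sZ, h2, h1, fun z hz => h z (h2 hz), by omega⟩
    have hyZ' : y ∉ Z := fun h => hyN (hZN h)
    have hZ' := hG.isSingular_span_insert sZ hyZ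
    have hsub : Z ⊆ G.span (insert y Z) := (Set.subset_insert _ _).trans (subset_span _)
    have hyI : y ∈ G.perp (N ∩ Y.1) := perp_anti hIZ hyZ
    have hdim : (k : ℤ) - c ≤ G.dim (G.span (insert y Z) ∩ Y.1) := by
      have h1 := hG.dim_span_insert hI hyI (fun h => hyN h.1)
      have h2 := hG.dim_mono (hZ'.subset_of_inter sY.1) (hG.isSingular_span_insert hI hyI)
        (Set.subset_inter (span_mono (Set.insert_subset_insert hIZ))
          (span_subset sY.1 (Set.insert_subset hy Set.inter_subset_right)))
      push_cast at hY
      omega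
    have h1 := ih (X := ⟨Z, hG.hasDim_iff.2 ⟨sZ, dZ⟩⟩) hZ'
      (by rw [hG.dim_span_insert sZ hyZ hyZ', dZ]) hsub hdim (hZ'.subset_of_inter sY.1)
    have h2 := hG.edist_le_one hk (X := X) (Y := ⟨Z, hG.hasDim_iff.2 ⟨sZ, dZ⟩⟩) hN hd hX hZN
    refine SimpleGraph.edist_triangle.trans ((add_le_add h2 h1).trans ?_)
    push_cast
    rw [add_comm]

theorem edist_le_of_common_subspace (hn : G.HasRank n) (hk : k + 1 < n) (c : ℕ)
    {X Y : G.Grassmannian k} {A : Set P} (hA : G.IsSingular A) (hAX : A ⊆ X.1) (hAY : A ⊆ Y.1)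
    (hd : (k : ℤ) - c ≤ G.dim A) : (G.grassmannGraph n k).edist X Y ≤ c + 1 := by
  obtain ⟨sX, dX⟩ := hG.hasDim_iff.1 X.2
  obtain ⟨U, hU, hXU, dU⟩ := hG.exists_maximal hn sX
  obtain ⟨N, hN, hXN, -, dN⟩ := hG.exists_between hU sX hXU (d := k + 1) (by omega) (by omega)
  exact hG.edist_le_of_subset hk c hN dN hXN (hd.trans
    (hG.dim_mono (hN.subset_of_inter (hG.hasDim_iff.1 Y.2).1.1) hA
      (Set.subset_inter (hAX.trans hXN) hAY)))

theorem adj_iff (hk : k + 1 < n) {X Y : G.Grassmannian k} : (G.grassmannGraph n k).Adj X Y ↔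
    X ≠ Y ∧ ∃ U, G.IsSingular U ∧ G.dim U = k + 1 ∧ X.1 ⊆ U ∧ Y.1 ⊆ U := by
  refine and_congr_right fun _ => ⟨?_, ?_⟩
  · rintro (⟨-, U, hU, h⟩ | ⟨h, -⟩)
    · exact ⟨U, (hG.hasDim_iff.1 hU).1, (hG.hasDim_iff.1 hU).2, h⟩
    · omega
  · rintro ⟨U, hU, hd, h⟩
    exact Or.inl ⟨hk, U, hG.hasDim_iff.2 ⟨hU, hd⟩, h⟩

/-- Adjacent vertices are hyperplanes of a common subspace, so each step loses at most one dimension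
of the intersection. -/
theorem le_dim_inter_of_walk (hk : k + 1 < n) {X Y : G.Grassmannian k}
    (p : (G.grassmannGraph n k).Walk X Y) : (k : ℤ) - p.length ≤ G.dim (X.1 ∩ Y.1) := by
  induction p with
  | @nil Z =>
    rw [Set.inter_self, (hG.hasDim_iff.1 Z.2).2]
    simp
  | @cons X Z Y h p ih =>
    obtain ⟨hne, U, sU, dU, hXU, hZU⟩ := (hG.adj_iff hk).1 h
    obtain ⟨sX, dX⟩ := hG.hasDim_iff.1 X.2
    obtain ⟨sY, dY⟩ := hG.hasDim_iff.1 Y.2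
    obtain ⟨sZ, dZ⟩ := hG.hasDim_iff.1 Z.2
    have h1 := hG.dim_inter_of_hyperplane sU sX (sZ.subset_of_inter sY.1) hXU
      (Set.inter_subset_left.trans hZU) (by omega)
    have h2 := hG.dim_mono (sX.subset_of_inter sY.1)
      ((sZ.subset_of_inter sY.1).subset_of_inter sX.1) fun x hx => ⟨hx.2, hx.1.2⟩
    rw [SimpleGraph.Walk.length_cons]
    push_cast
    omega

/-- The first vertex Z after Y on a short walk to X meets X in more than X ∩ Y, hence in a point
outside Y. That point is perpendicular to Y since Y and Z lie in one singular subspace. -/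
theorem exists_mem_perp_of_edist_le (hk : k + 1 < n) {X Y : G.Grassmannian k} {r : ℕ}
    (hr : 1 ≤ r) (h : (G.grassmannGraph n k).edist X Y ≤ r)
    (hd : G.dim (X.1 ∩ Y.1) ≤ (k : ℤ) - r) : ∃ x ∈ X.1, x ∉ Y.1 ∧ x ∈ G.perp Y.1 := by
  rw [SimpleGraph.edist_comm] at h
  obtain ⟨p, hp⟩ := SimpleGraph.exists_walk_of_edist_ne_top
    (ne_top_of_le_ne_top (ENat.natCast_ne_top r) h)
  rw [← hp, Nat.cast_le] at h
  cases p with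
  | nil =>
    rw [Set.inter_self, (hG.hasDim_iff.1 X.2).2] at hd
    omega
  | @cons _ Z _ hYZ p =>
    obtain ⟨hne, U, sU, dU, hYU, hZU⟩ := (hG.adj_iff hk).1 hYZ
    obtain ⟨sX, dX⟩ := hG.hasDim_iff.1 X.2
    obtain ⟨sY, dY⟩ := hG.hasDim_iff.1 Y.2
    obtain ⟨sZ, dZ⟩ := hG.hasDim_iff.1 Z.2
    have h1 := hG.le_dim_inter_of_walk hk p
    rw [SimpleGraph.Walk.length_cons] at h
    obtain ⟨x, hx, hxY⟩ : ∃ x ∈ Z.1 ∩ X.1, x ∉ Y.1 := by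
      by_contra! hc
      have := hG.dim_mono (sX.subset_of_inter sY.1) (sZ.subset_of_inter sX.1)
        fun x hx => ⟨hx.2, hc x hx⟩
      omega
    exact ⟨x, hx.2, hxY, fun y hy => hG.subset_perp sU (hZU hx.1) y (hYU hy)⟩

end Distance

end IsWeakPolarSpace

end PointLineGeometry

/-! ### From local to global intersections over a fixed subspace. -/

namespace PointLineGeometry

variable {P : Type*} {G : PointLineGeometry P}

/-- `X` is a singular subspace which contains `A` as a hyperplane. -/
def IsOver (G : PointLineGeometry P) (A X : Set P) : Prop :=
  G.IsSingular X ∧ A ⊆ X ∧ G.dim X = G.dim A + 1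

namespace IsWeakPolarSpace

variable (hG : G.IsWeakPolarSpace)
include hG

theorem isOver_span_insert {A : Set P} (hA : G.IsSingular A) {w : P} (hw : w ∈ G.perp A)
    (hwA : w ∉ A) : G.IsOver A (G.span (insert w A)) :=
  ⟨hG.isSingular_span_insert hA hw, (Set.subset_insert _ _).trans (subset_span _),
    hG.dim_span_insert hA hw hwA⟩

theorem exists_mem_of_isOver {A X : Set P} (hA : G.IsSingular A) (hX : G.IsOver A X) :
    ∃ x ∈ X, x ∉ A ∧ X = G.span (insert x A) := by
  have hne : A ⊂ X := hX.2.1.ssubset_of_ne (by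
    rintro rfl
    have := hX.2.2
    omega)
  obtain ⟨x, hx, hxA⟩ := Set.exists_of_ssubset hne
  exact ⟨x, hx, hxA, hG.eq_span_insert hX.1 hA hX.2.1 hX.2.2.le hx hxA⟩

theorem subset_perp_span_insert {A X : Set P} (hAX : A ⊆ X) (hX : G.IsSingular X) {w : P}
    (hw : w ∈ G.perp X) : X ⊆ G.perp (G.span (insert w A)) :=
  fun x hx => hG.mem_perp_span_insert (perp_anti hAX (hG.subset_perp hX hx)) (hw x hx).symm

theorem mem_perp_of_mem {U X : Set P} (hU : G.IsSingular U) (hX : X ⊆ U) {u : P} (hu : u ∈ U) :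
    u ∈ G.perp X :=
  fun x hx => hG.subset_perp hU hu x (hX hx)

variable {n : ℕ} (hn : G.HasRank n)
include hn

/-- Local constancy of intersections implies that all images contain a common intersection. -/
theorem exists_inter_subset {α : Type*} {A : Set P} (hA : G.IsSingular A) (hd : G.dim A + 4 ≤ n)
    (F : Set P → Set α)
    (htri : ∀ X Y Z, G.IsOver A X → G.IsOver A Y → G.IsOver A Z → X ≠ Y → X ≠ Z →
      X ⊆ G.perp Y → X ⊆ G.perp Z → Y ⊆ G.perp Z → ¬ Z ⊆ G.span (X ∪ Y) →
      F X ∩ F Y = F X ∩ F Z) :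
    ∃ X Y, G.IsOver A X ∧ G.IsOver A Y ∧ X ≠ Y ∧ X ⊆ G.perp Y ∧
      ∀ Z, G.IsOver A Z → F X ∩ F Y ⊆ F Z := by
  have hW : ∀ {X Y w}, G.IsOver A X → G.IsOver A Y → X ≠ Y → X ⊆ G.perp Y → w ∈ G.perp X →
      w ∈ G.perp Y → w ∉ G.span (X ∪ Y) → F X ∩ F Y = F X ∩ F (G.span (insert w A)) := by
    intro X Y w hX hY hne hXY hwX hwY hw
    have hwXm : w ∉ X := fun h => hw (subset_span _ (Or.inl h))
    have hwW : w ∈ G.span (insert w A) := subset_span _ (Or.inl rfl)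
    exact htri X Y _ hX hY (hG.isOver_span_insert hA (perp_anti hX.2.1 hwX)
      fun h => hwXm (hX.2.1 h)) hne (fun h => hwXm (h ▸ hwW)) hXY
      (hG.subset_perp_span_insert hX.2.1 hX.1 hwX) (hG.subset_perp_span_insert hY.2.1 hY.1 hwY)
      fun h => hw (h hwW)
  -- For fixed X the intersection does not depend on the perpendicular neighbour: unless `htri`
  -- applies directly, Y and Y' are compared through ⟨w,A⟩ with w perpendicular to all three and
  -- outside both joins.
  have hloc : ∀ X Y Y', G.IsOver A X → G.IsOver A Y → G.IsOver A Y' → X ≠ Y → X ≠ Y' →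
      X ⊆ G.perp Y → X ⊆ G.perp Y' → F X ∩ F Y = F X ∩ F Y' := by
    intro X Y Y' hX hY hY' hne hne' hXY hXY'
    by_cases hcase : Y ⊆ G.perp Y' ∧ ¬ Y' ⊆ G.span (X ∪ Y)
    · exact htri X Y Y' hX hY hY' hne hne' hXY hXY' hcase.1 hcase.2
    suffices ∃ w, w ∈ G.perp X ∧ w ∈ G.perp Y ∧ w ∈ G.perp Y' ∧ w ∉ G.span (X ∪ Y) ∧
        w ∉ G.span (X ∪ Y') by
      obtain ⟨w, h1, h2, h3, h4, h5⟩ := this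
      rw [hW hX hY hne hXY h1 h2 h4, hW hX hY' hne' hXY' h1 h3 h5]
    obtain ⟨y, hyY, hyX, hyp, hYe, hJ, hdJ⟩ :=
      hG.exists_join hA hX.1 hY.1 hX.2.1 hY.2.1 hXY hne hX.2.2 hY.2.2
    obtain ⟨y', hyY', hyX', hyp', hYe', hJ', hdJ'⟩ :=
      hG.exists_join hA hX.1 hY'.1 hX.2.1 hY'.2.1 hXY' hne' hX.2.2 hY'.2.2
    have hJs : G.IsSingular (G.span (X ∪ Y)) := hG.isSingular_span_union hX.1 hY.1 hXY
    obtain ⟨U, hU, hJU, hdU⟩ := hG.exists_maximal hn hJs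
    have hXU : X ⊆ U := (Set.subset_union_left.trans (subset_span _)).trans hJU
    have hYU : Y ⊆ U := (Set.subset_union_right.trans (subset_span _)).trans hJU
    have hdX := hX.2.2
    by_cases hYY' : Y ⊆ G.perp Y'
    · have hsub : Y' ⊆ G.span (X ∪ Y) := by
        by_contra h
        exact hcase ⟨hYY', h⟩
      obtain ⟨w, hwU, hw⟩ : ∃ w ∈ U, w ∉ G.span (X ∪ Y) := by
        by_contra! h
        have := hG.dim_mono hJs hU h
        omega
      exact ⟨w, hG.mem_perp_of_mem hU hXU hwU, hG.mem_perp_of_mem hU hYU hwU,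
        hG.mem_perp_of_mem hU (hsub.trans hJU) hwU, hw, fun h => hw (span_subset hJs.1
          (Set.union_subset (Set.subset_union_left.trans (subset_span _)) hsub) h)⟩
    · have hy'Y : ¬ G.Collinear y' y := by
        intro h
        refine hYY' (subset_perp_comm.1 ?_)
        rw [hYe, hYe']
        refine hG.span_subset_perp_span ?_
        rintro x (rfl | hx) z (rfl | hz)
        · exact h
        · exact hyp' z (hX.2.1 hz)
        · exact (hyp x (hX.2.1 hx)).symm
        · exact hG.subset_perp hA hx z hz
      have h1 := hG.le_dim_inter_perp_singleton hU y'
      -- Since w is collinear to both y and y', which are not collinear, it could lie in either join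
      -- only by lying in X.
      obtain ⟨w, ⟨hwU, hwy'⟩, hwX⟩ : ∃ w ∈ U ∩ G.perp {y'}, w ∉ X := by
        by_contra! h
        have := hG.dim_mono hX.1 (hG.isSingular_inter_perp hU _) h
        omega
      have hwy' : G.Collinear w y' := hwy' y' rfl
      refine ⟨w, hG.mem_perp_of_mem hU hXU hwU, hG.mem_perp_of_mem hU hYU hwU, ?_, ?_, ?_⟩
      · rw [hYe']
        exact hG.mem_perp_span_insert (hG.mem_perp_of_mem hU (hX.2.1.trans hXU) hwU) hwy'
      · intro h
        rw [hJ] at h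
        exact hwX (hG.mem_of_mem_span_insert hX.1 hyp hyp' hy'Y h hwy'.symm)
      · intro h
        rw [hJ'] at h
        exact hwX (hG.mem_of_mem_span_insert hX.1 hyp' hyp (fun h => hy'Y h.symm) h
          (hG.subset_perp hU (hYU hyY) w hwU))
  obtain ⟨U, hU, hAU, hdU⟩ := hG.exists_maximal hn hA
  obtain ⟨X, sX, hAX, hXU, dX⟩ := hG.exists_between hU hA hAU (d := G.dim A + 1) (by omega)
    (by omega)
  have hX : G.IsOver A X := ⟨sX, hAX, dX⟩
  obtain ⟨y, hyU, hyX⟩ : ∃ y ∈ U, y ∉ X := by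
    by_contra! h
    have := hG.dim_mono sX hU h
    omega
  have hnbr : ∀ {X w}, G.IsOver A X → w ∈ G.perp X → w ∉ X →
      G.IsOver A (G.span (insert w A)) ∧ X ≠ G.span (insert w A) ∧
        X ⊆ G.perp (G.span (insert w A)) := fun hX hw hwX =>
    ⟨hG.isOver_span_insert hA (perp_anti hX.2.1 hw) fun h => hwX (hX.2.1 h),
      fun h => hwX (h ▸ subset_span _ (Or.inl rfl)), hG.subset_perp_span_insert hX.2.1 hX.1 hw⟩
  obtain ⟨hY, hne, hXY⟩ := hnbr hX (hG.mem_perp_of_mem hU hXU hyU) hyX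
  refine ⟨X, _, hX, hY, hne, hXY, fun Z hZ => ?_⟩
  by_cases hXZ : X = Z
  · rw [← hXZ]
    exact Set.inter_subset_left
  by_cases hperp : X ⊆ G.perp Z
  · rw [hloc X _ Z hX hY hZ hne hXZ hXY hperp]
    exact Set.inter_subset_right
  obtain ⟨z, hzZ, hzA, hZe⟩ := hG.exists_mem_of_isOver hA hZ
  have hzp : z ∈ G.perp A := hG.mem_perp_of_mem hZ.1 hZ.2.1 hzZ
  have hzX : ¬ z ∈ G.perp X := fun h => hperp (by
    rw [hZe]
    exact hG.subset_perp_span_insert hX.2.1 sX h)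
  have h1 := hG.le_dim_inter_perp_singleton hU z
  -- W = ⟨w,A⟩ is a common neighbour of X and Z, so F(X) ∩ F(Y) = F(X) ∩ F(W) = F(W) ∩ F(Z).
  obtain ⟨w, ⟨hwU, hwz⟩, hwA⟩ : ∃ w ∈ U ∩ G.perp {z}, w ∉ A := by
    by_contra! h
    have := hG.dim_mono hA (hG.isSingular_inter_perp hU _) h
    omega
  have hwz : G.Collinear w z := hwz z rfl
  have hwpX : w ∈ G.perp X := hG.mem_perp_of_mem hU hXU hwU
  have hwpZ : w ∈ G.perp Z := by
    rw [hZe]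
    exact hG.mem_perp_span_insert (hG.mem_perp_of_mem hU hAU hwU) hwz
  have hwX : w ∉ X := by
    intro h
    refine hzX ?_
    rw [hG.eq_span_insert sX hA hAX dX.le h hwA]
    exact hG.mem_perp_span_insert hzp hwz.symm
  have hwZ : w ∉ Z := by
    intro h
    refine hzX fun x hx => ?_
    have hxZ : x ∈ G.perp Z := by
      rw [hG.eq_span_insert hZ.1 hA hZ.2.1 hZ.2.2.le h hwA]
      exact hG.mem_perp_span_insert (hG.mem_perp_of_mem sX hAX hx) (hwpX x hx).symm
    exact (hxZ z hzZ).symm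
  obtain ⟨hW', hneX, hXW⟩ := hnbr hX hwpX hwX
  obtain ⟨-, hneZ, hZW⟩ := hnbr hZ hwpZ hwZ
  rw [hloc X _ _ hX hY hW' hne hneX hXY hXW, Set.inter_comm,
    hloc _ X Z hW' hX hZ hneX.symm hneZ.symm (subset_perp_comm.1 hXW) (subset_perp_comm.1 hZW)]
  exact Set.inter_subset_right

omit hn

/-! ### Collinearity and subspaces in the quotient geometry. -/

section Quotient

theorem quotient_collinear_iff {S : Set P} (hS : G.IsSingular S) {d : ℤ} (hd : G.dim S = d - 1)
    {x y : G.bigStar S d} (hne : x ≠ y) :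
    (G.quotient S d).Collinear x y ↔ x.1 ⊆ G.perp y.1 := by
  obtain ⟨sx, dx⟩ := hG.hasDim_iff.1 x.2.1
  obtain ⟨sy, dy⟩ := hG.hasDim_iff.1 y.2.1
  constructor
  · rintro ⟨_, ⟨U, hU, -, rfl⟩, hx, hy⟩
    exact fun a ha => hG.mem_perp_of_mem (hG.hasDim_iff.1 hU).1 hy (hx ha)
  · intro h
    obtain ⟨-, -, -, -, -, -, hdim⟩ := hG.exists_join hS sx sy x.2.2 y.2.2 h
      (fun e => hne (Subtype.ext e)) (by omega) (by omega)
    exact ⟨_, ⟨_, hG.hasDim_iff.2 ⟨hG.isSingular_span_union sx sy h, by rw [hdim, dx]⟩,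
      x.2.2.trans (Set.subset_union_left.trans (subset_span _)), rfl⟩,
      Set.subset_union_left.trans (subset_span _), Set.subset_union_right.trans (subset_span _)⟩

theorem isSubspace_quotient {S : Set P} {d : ℤ} {V : Set P} (hV : G.IsSubspace V) :
    (G.quotient S d).IsSubspace {x | x.1 ⊆ V} := by
  rintro _ ⟨U, hU, -, rfl⟩ x hx y hy hne hxV hyV z hz
  obtain ⟨sU, dU⟩ := hG.hasDim_iff.1 hU
  obtain ⟨sx, dx⟩ := hG.hasDim_iff.1 x.2.1
  obtain ⟨sy, dy⟩ := hG.hasDim_iff.1 y.2.1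
  obtain ⟨a, hay, hax⟩ : ∃ a ∈ y.1, a ∉ x.1 := by
    by_contra! h
    exact hne (Subtype.ext (hG.eq_of_subset_of_dim_le sx sy h (by omega)).symm)
  have h := hG.eq_span_insert sU sx hx (by omega) (hy hay) hax
  exact hz.trans (h.subset.trans (span_subset hV (Set.insert_subset (hyV hay) hxV)))

/-- For x not in H₁, choose a quotient point x₁ in H₁ but not in H₂. The line through x and x₁ meets
H₂ in a point other than x₁, so it lies in T. -/
theorem mem_of_hyperplanes {S : Set P} (hS : G.IsSingular S) {d : ℤ} (hd : G.dim S = d - 1)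
    {V H₁ H₂ : Set P} (hV : G.IsSingular V) (h₁ : G.IsSingular H₁) (h₂ : G.IsSingular H₂)
    (hV₁ : H₁ ⊆ V) (hV₂ : H₂ ⊆ V) (hS₁ : S ⊆ H₁) (hS₂ : S ⊆ H₂) (hd₁ : G.dim V = G.dim H₁ + 1)
    (hd₂ : G.dim V = G.dim H₂ + 1) (hne : H₁ ≠ H₂) {T : Set (G.bigStar S d)}
    (hT : (G.quotient S d).IsSubspace T) (hT₁ : ∀ x : G.bigStar S d, x.1 ⊆ H₁ → x ∈ T)
    (hT₂ : ∀ x : G.bigStar S d, x.1 ⊆ H₂ → x ∈ T) {x : G.bigStar S d} (hx : x.1 ⊆ V) : x ∈ T := by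
  by_cases hxH₁ : x.1 ⊆ H₁
  · exact hT₁ x hxH₁
  obtain ⟨sx, dx⟩ := hG.hasDim_iff.1 x.2.1
  obtain ⟨q, hq₁, hq₂⟩ : ∃ q ∈ H₁, q ∉ H₂ := by
    by_contra! h
    exact hne (hG.eq_of_subset_of_dim_le h₂ h₁ h (by omega))
  have hqS : q ∉ S := fun h => hq₂ (hS₂ h)
  have hqp : q ∈ G.perp S := hG.mem_perp_of_mem h₁ hS₁ hq₁
  have hx₁ := hG.isOver_span_insert hS hqp hqS
  set x₁ : G.bigStar S d := ⟨G.span (insert q S),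
    hG.hasDim_iff.2 ⟨hx₁.1, by rw [hx₁.2.2, hd]; omega⟩, hx₁.2.1⟩
  have hx₁H : x₁.1 ⊆ H₁ := span_subset h₁.1 (Set.insert_subset hq₁ hS₁)
  have hqx₁ : q ∈ x₁.1 := subset_span _ (Or.inl rfl)
  have hperp : x.1 ⊆ G.perp x₁.1 := fun a ha =>
    hG.mem_perp_of_mem hV (hx₁H.trans hV₁) (hx ha)
  have hxx₁ : x.1 ≠ x₁.1 := fun h => hxH₁ (h ▸ hx₁H)
  obtain ⟨-, -, -, -, -, -, hdU⟩ := hG.exists_join hS sx hx₁.1 x.2.2 hx₁.2.1 hperp hxx₁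
    (by omega) hx₁.2.2
  have sU := hG.isSingular_span_union sx hx₁.1 hperp
  set U := G.span (x.1 ∪ x₁.1)
  have hxU : x.1 ⊆ U := Set.subset_union_left.trans (subset_span _)
  have hx₁U : x₁.1 ⊆ U := Set.subset_union_right.trans (subset_span _)
  have hUV : U ⊆ V := span_subset hV.1 (Set.union_subset hx (hx₁H.trans hV₁))
  have h3 := hG.dim_inter_of_hyperplane hV h₂ sU hV₂ hUV hd₂.le
  obtain ⟨y, sy, hSy, hyU, dy⟩ := hG.exists_between (sU.subset_of_inter h₂.1) hS
    (Set.subset_inter (x.2.2.trans hxU) hS₂) (d := d) (by omega) (by omega)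
  set x₂ : G.bigStar S d := ⟨y, hG.hasDim_iff.2 ⟨sy, dy⟩, hSy⟩
  refine hT _ ⟨U, hG.hasDim_iff.2 ⟨sU, by omega⟩, x.2.2.trans hxU, rfl⟩ x₁ hx₁U x₂
    (hyU.trans Set.inter_subset_left) (fun h => hq₂ ?_) (hT₁ _ hx₁H)
    (hT₂ _ (hyU.trans Set.inter_subset_right)) hxU
  have : q ∈ x₂.1 := h ▸ hqx₁
  exact (hyU this).2

end Quotient

end IsWeakPolarSpace

/-! ### Polar and thin polar spaces satisfy the common axioms. -/

theorem IsPolarSpace.isWeakPolarSpace (h : G.IsPolarSpace) : G.IsWeakPolarSpace where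
  refl x := by
    obtain ⟨L, hL, hx⟩ := h.exists_line x
    exact ⟨L, hL, hx, hx⟩
  no_radical x := by
    by_contra! hc
    exact h.no_radical ⟨x, hc⟩
  line_perp L hL x a ha b hb hab hxa hxb := by
    rcases h.one_or_all x L hL with h1 | h1
    · exact absurd (h1.unique ⟨ha, hxa⟩ ⟨hb, hxb⟩) hab
    · exact h1
  exists_perp x L hL hne := by
    rcases h.one_or_all x L hL with ⟨y, hy, -⟩ | h1
    · exact ⟨y, hy⟩
    · exact ⟨hne.some, hne.some_mem, h1 _ hne.some_mem⟩
  finite_chains := h.finite_chains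

/-- Rank at least two provides a line, hence two different indices. So every point lies on a line,
which `Collinear` requires for reflexivity. -/
theorem IsThinPolarSpace.isWeakPolarSpace (h : G.IsThinPolarSpace) {n : ℕ} (hn : G.HasRank n)
    (h2 : 2 ≤ n) : G.IsWeakPolarSpace := by
  obtain ⟨m, e, he⟩ := h
  have hpair : ∀ L ∈ G.lines, ∃ a b, a ≠ b ∧ (e a).1 ≠ (e b).1 ∧ L = {a, b} := by
    intro L hL
    obtain ⟨i, j, hij, hij', hL⟩ := (he L).1 hL
    refine ⟨e.symm i, e.symm j, e.symm.injective.ne hij, ?_, ?_⟩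
    · simp only [Equiv.apply_symm_apply]
      intro h
      obtain ⟨i, b⟩ := i
      obtain ⟨j, c⟩ := j
      simp only at h
      subst h
      cases b <;> cases c <;> simp_all
    · rw [← e.symm_image_image L, hL, Set.image_pair]
  have hline : ∀ {a b}, (e a).1 ≠ (e b).1 → ({a, b} : Set P) ∈ G.lines := by
    intro a b hab
    refine (he _).2 ⟨e a, e b, fun h => hab (by rw [h]), fun h => hab (by rw [h]), ?_⟩
    rw [Set.image_pair]
  have hcol : ∀ {a b}, (e a).1 ≠ (e b).1 → G.Collinear a b := fun hab =>
    ⟨_, hline hab, Or.inl rfl, Or.inr rfl⟩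
  obtain ⟨L₀, hL₀⟩ : G.lines.Nonempty := by
    obtain ⟨S, hS, r, hr, hr'⟩ := hn.1
    have h1 : ¬ Order.height (⟨S, hS⟩ : {T : Set P // G.IsSingular T}) ≤ (1 : ℕ) := by
      rw [hr, Nat.cast_le]
      omega
    rw [Order.height_le_coe_iff] at h1
    push Not at h1
    obtain ⟨T, hTS, hT⟩ := h1
    obtain ⟨y, hy, hyT⟩ := Set.exists_of_ssubset (show T.1 ⊂ S from hTS)
    obtain ⟨x, hx⟩ : T.1.Nonempty := by
      by_contra! hc
      rw [Order.height_eq_zero.2 (fun R _ => by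
        change T.1 ⊆ R.1
        rw [hc]
        exact Set.empty_subset _)] at hT
      simp at hT
    obtain ⟨L, hL, -⟩ := hS.2 x (hTS.le hx) y hy (fun h => hyT (h ▸ hx))
    exact ⟨L, hL⟩
  obtain ⟨a₀, b₀, -, hab₀, -⟩ := hpair L₀ hL₀
  have hrefl : ∀ x, G.Collinear x x := by
    intro x
    by_cases hx : (e x).1 = (e a₀).1
    · exact ⟨_, hline (a := x) (b := b₀) (by rwa [hx]), Or.inl rfl, Or.inl rfl⟩
    · exact ⟨_, hline hx, Or.inl rfl, Or.inl rfl⟩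
  refine ⟨hrefl, fun x => ?_, ?_, ?_, ?_⟩
  · refine ⟨e.symm ((e x).1, !(e x).2), ?_⟩
    rintro ⟨L, hL, hx, hy⟩
    obtain ⟨a, b, hab, hab', rfl⟩ := hpair L hL
    have hne : x ≠ e.symm ((e x).1, !(e x).2) := by
      intro h
      have h3 := congrArg (fun z => (e z).2) h
      simp at h3
    rcases hx with rfl | rfl <;> rcases hy with hy | hy
    · exact hne hy.symm
    · exact hab' (by rw [← hy]; simp)
    · exact hab' (by rw [← hy]; simp)
    · exact hne hy.symm
  · intro L hL x a ha b hb hab hxa hxb c hc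
    obtain ⟨a', b', -, -, rfl⟩ := hpair L hL
    rcases ha with rfl | rfl <;> rcases hb with rfl | rfl <;> rcases hc with rfl | rfl <;>
      first | assumption | exact absurd rfl hab
  · intro x L hL _
    obtain ⟨a, b, hab, hab', rfl⟩ := hpair L hL
    by_cases hx : (e x).1 = (e a).1
    · exact ⟨b, Or.inr rfl, hcol (by rwa [hx])⟩
    · exact ⟨a, Or.inl rfl, hcol hx⟩
  · intro C _ _
    have : Finite P := Finite.of_equiv _ e.symm
    exact Set.toFinite C

end PointLineGeometry

/-! ### Star embeddings and the dimension formula. -/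

namespace PointLineGeometry

variable {P P' : Type*} {G : PointLineGeometry P} {G' : PointLineGeometry P'}

/-- The intersection of the images of all `k`-dimensional singular subspaces containing `A`. -/
def meetImage {k k' : ℕ} (f : G.Grassmannian k → G'.Grassmannian k') (A : Set P) : Set P' :=
  {y | ∀ X : G.Grassmannian k, A ⊆ X.1 → y ∈ (f X).1}

theorem meetImage_mono {k k' : ℕ} (f : G.Grassmannian k → G'.Grassmannian k') {A B : Set P}
    (h : A ⊆ B) : meetImage f A ⊆ meetImage f B :=
  fun _ hy X hX => hy X (h.trans hX)

/-- An isometric embedding of polar Grassmann graphs sending stars into stars. -/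
structure IsStarEmbedding (G : PointLineGeometry P) (G' : PointLineGeometry P') (n n' k k' : ℕ)
    (f : G.Grassmannian k → G'.Grassmannian k') : Prop where
  weak : G.IsWeakPolarSpace
  weak' : G'.IsWeakPolarSpace
  rank : G.HasRank n
  rank' : G'.HasRank n'
  one_le : 1 ≤ k
  le_rank : k + 3 ≤ n
  le_rank' : k' + 1 ≤ n'
  injective : Function.Injective f
  adj_of_adj : ∀ X Y, (G'.grassmannGraph n' k').Adj (f X) (f Y) → (G.grassmannGraph n k).Adj X Y
  edist_eq : ∀ X Y, (G'.grassmannGraph n' k').edist (f X) (f Y) = (G.grassmannGraph n k).edist X Y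
  star : ∀ 𝒳, G.IsStar n k 𝒳 → ∃ 𝒴, G'.IsStar n' k' 𝒴 ∧ f '' 𝒳 ⊆ 𝒴

namespace IsStarEmbedding

variable {n n' k k' : ℕ} {f : G.Grassmannian k → G'.Grassmannian k'}
  (hf : G.IsStarEmbedding G' n n' k k' f)
include hf

theorem meetImage_eq (X : G.Grassmannian k) : meetImage f X.1 = (f X).1 := by
  refine Set.Subset.antisymm (fun y hy => hy X subset_rfl) fun y hy Z hZ => ?_
  obtain ⟨sX, dX⟩ := hf.weak.hasDim_iff.1 X.2
  obtain ⟨sZ, dZ⟩ := hf.weak.hasDim_iff.1 Z.2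
  have : X = Z := Subtype.ext (hf.weak.eq_of_subset_of_dim_le sZ sX hZ (by omega))
  exact this ▸ hy

theorem exists_grassmannian {A : Set P} (hA : G.IsSingular A) (hd : G.dim A ≤ k) :
    ∃ X : G.Grassmannian k, A ⊆ X.1 := by
  have := hf.le_rank
  obtain ⟨U, hU, hAU, hdU⟩ := hf.weak.exists_maximal hf.rank hA
  obtain ⟨X, sX, hAX, -, dX⟩ := hf.weak.exists_between hU hA hAU hd (by omega)
  exact ⟨⟨X, hf.weak.hasDim_iff.2 ⟨sX, dX⟩⟩, hAX⟩

theorem isSingular_meetImage {A : Set P} (hA : G.IsSingular A) (hd : G.dim A ≤ k) :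
    G'.IsSingular (meetImage f A) := by
  obtain ⟨X, hAX⟩ := hf.exists_grassmannian hA hd
  refine ⟨fun L hL x hx y hy hxy hxS hyS z hz Y hY =>
    (hf.weak'.hasDim_iff.1 (f Y).2).1.1 L hL x hx y hy hxy (hxS Y hY) (hyS Y hY) hz,
    fun x hx y hy hxy => (hf.weak'.hasDim_iff.1 (f X).2).1.2 x (hx X hAX) y (hy X hAX) hxy⟩

theorem exists_star {A W : Set P} (hA : G.IsSingular A) (hd : G.dim A = k - 1)
    (hW : G.IsSingular W) (hAW : A ⊆ W) :
    ∃ S U, G'.IsSingular S ∧ G'.dim S = k' - 1 ∧ G'.IsSingular U ∧ G'.dim U = n' - 1 ∧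
      ∀ X : G.Grassmannian k, A ⊆ X.1 → X.1 ⊆ W → S ⊆ (f X).1 ∧ (f X).1 ⊆ U := by
  obtain ⟨U, hU, hWU, hdU⟩ := hf.weak.exists_maximal hf.rank hW
  obtain ⟨_, ⟨S', U', hS', hU', -, rfl⟩, h⟩ := hf.star _ ⟨A, U, hf.weak.hasDim_iff.2 ⟨hA, hd⟩,
    hf.weak.hasDim_iff.2 ⟨hU, hdU⟩, hAW.trans hWU, rfl⟩
  obtain ⟨sS, dS⟩ := hf.weak'.hasDim_iff.1 hS'
  obtain ⟨sU, dU⟩ := hf.weak'.hasDim_iff.1 hU'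
  exact ⟨S', U', sS, dS, sU, dU, fun X h1 h2 => h ⟨X, ⟨h1, h2.trans hWU⟩, rfl⟩⟩

theorem succ_lt : k + 1 < n := by
  have := hf.le_rank
  omega

/-- If k' = n' - 1, every star of the target has at most one element. But a star of the source has
two, and f is injective. -/
theorem succ_lt' : k' + 1 < n' := by
  have hk := hf.le_rank
  have hk1 := hf.one_le
  have hk' := hf.le_rank'
  obtain ⟨U, hU, -, hdU⟩ := hf.weak.exists_maximal hf.rank isSingular_empty
  obtain ⟨A, sA, -, hAU, dA⟩ := hf.weak.exists_between hU isSingular_empty (Set.empty_subset _)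
    (d := k - 1) (by rw [dim_empty]; omega) (by omega)
  obtain ⟨X, sX, hAX, hXU, dX⟩ := hf.weak.exists_between hU sA hAU (d := k) (by omega) (by omega)
  obtain ⟨y, hyU, hyX⟩ : ∃ y ∈ U, y ∉ X := by
    by_contra! h
    have := hf.weak.dim_mono sX hU h
    omega
  have hY := hf.weak.isOver_span_insert sA (hf.weak.mem_perp_of_mem hU hAU hyU)
    (fun h => hyX (hAX h))
  obtain ⟨S', U', sS, dS, sU, dU, h⟩ := hf.exists_star sA dA hU hAU
  set X' : G.Grassmannian k := ⟨X, hf.weak.hasDim_iff.2 ⟨sX, dX⟩⟩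
  set Y' : G.Grassmannian k :=
    ⟨_, hf.weak.hasDim_iff.2 ⟨hY.1, by rw [hY.2.2, dA]; omega⟩⟩
  have h1 := (h X' hAX hXU).2
  have h2 := (h Y' hY.2.1 (span_subset hU.1 (Set.insert_subset hyU hAU))).2
  obtain ⟨s1, d1⟩ := hf.weak'.hasDim_iff.1 (f X').2
  obtain ⟨s2, d2⟩ := hf.weak'.hasDim_iff.1 (f Y').2
  by_contra hc
  have e1 := hf.weak'.eq_of_subset_of_dim_le sU s1 h1 (by omega)
  have e2 := hf.weak'.eq_of_subset_of_dim_le sU s2 h2 (by omega)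
  have e := congrArg Subtype.val (hf.injective (Subtype.ext (e1.trans e2.symm)))
  have hyY : y ∈ Y'.1 := subset_span _ (Or.inl rfl)
  rw [← e] at hyY
  exact hyX hyY

/-- Distinct adjacent subspaces of dimension less than `k` have different images, since they are
contained in `k`-dimensional subspaces at a large distance. -/
theorem meetImage_ne {A₁ A₂ B : Set P} (hB : G.IsSingular B) (h₁ : G.IsOver B A₁)
    (h₂ : G.IsOver B A₂) (hperp : A₁ ⊆ G.perp A₂) (hne : A₁ ≠ A₂) (hd : G.dim B + 2 ≤ k)
    (hdF : G'.dim (meetImage f A₁) = k' - k + G.dim A₁) : meetImage f A₁ ≠ meetImage f A₂ := by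
  intro heq
  have hk := hf.le_rank
  have hB1 := neg_one_le_dim (G := G) B
  have hd₁ := h₁.2.2
  obtain ⟨X₁, X₂, s₁, s₂, i₁, i₂, d₁, d₂, h⟩ := hf.weak.exists_opposite hf.rank h₁.1 h₂.1 hB
    h₁.2.1 h₂.2.1 h₁.2.2 h₂.2.2 hperp hne hd (by omega)
  -- If F(A₁) = F(A₂), the images share a subspace of dimension k' - c, so X₁ and X₂ are at distance
  -- at most c + 1. But dim (X₁ ∩ X₂) ≤ dim B = k - (c + 1), so some point of X₁ outside X₂ is
  -- perpendicular to X₂, which the opposite position forbids.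
  obtain ⟨c, hc⟩ := Int.eq_ofNat_of_zero_le (show 0 ≤ (k : ℤ) - G.dim A₁ by omega)
  set Y₁ : G.Grassmannian k := ⟨X₁, hf.weak.hasDim_iff.2 ⟨s₁, d₁⟩⟩
  set Y₂ : G.Grassmannian k := ⟨X₂, hf.weak.hasDim_iff.2 ⟨s₂, d₂⟩⟩
  have h3 := hf.weak'.edist_le_of_common_subspace hf.rank' hf.succ_lt' c (X := f Y₁) (Y := f Y₂)
    (hf.isSingular_meetImage h₁.1 (by omega)) (fun y hy => hy Y₁ i₁)
    (fun y hy => (heq ▸ hy : y ∈ meetImage f A₂) Y₂ i₂) (by omega)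
  rw [hf.edist_eq] at h3
  have hsub : X₁ ∩ X₂ ⊆ B := fun x hx => h ⟨hx.1, hf.weak.subset_perp s₂ hx.2⟩
  obtain ⟨x, hx₁, hx₂, hx⟩ := hf.weak.exists_mem_perp_of_edist_le hf.succ_lt (r := c + 1)
    (by omega) (by exact_mod_cast h3) (by
      have := hf.weak.dim_mono hB (s₁.subset_of_inter s₂.1) hsub
      change G.dim (X₁ ∩ X₂) ≤ _
      push_cast
      omega)
  exact hx₂ (i₂ (h₂.2.1 (h ⟨hx₁, hx⟩)))

theorem dim_meetImage {A : Set P} (hA : G.IsSingular A) (hd : G.dim A ≤ k) :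
    G'.dim (meetImage f A) = k' - k + G.dim A := by
  have hk := hf.le_rank
  have hW := hf.weak
  have hW' := hf.weak'
  suffices ∀ m : ℕ, ∀ A, G.IsSingular A → G.dim A = k - m →
      G'.dim (meetImage f A) = k' - m by
    rw [this ((k : ℤ) - G.dim A).toNat A hA (by omega)]
    omega
  clear hd hA A
  intro m
  induction m using Nat.strong_induction_on with
  | _ m ih =>
  intro A hA hd
  rcases m with _ | m
  · obtain ⟨X, rfl⟩ : ∃ X : G.Grassmannian k, X.1 = A :=
      ⟨⟨A, hW.hasDim_iff.2 ⟨hA, by simpa using hd⟩⟩, rfl⟩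
    rw [hf.meetImage_eq, (hW'.hasDim_iff.1 (f X).2).2]
    simp
  push_cast at hd
  -- From here dim A = k - (m + 1), so the subspaces over A have dimension k - m and the induction
  -- hypothesis covers them.
  have hsing : ∀ {X}, G.IsOver A X → G'.IsSingular (meetImage f X) := fun {X} hX =>
    hf.isSingular_meetImage hX.1 (by have := hX.2.2; omega)
  have hdim : ∀ {X}, G.IsOver A X → G'.dim (meetImage f X) = k' - m := fun {X} hX =>
    ih m (by omega) X hX.1 (by have := hX.2.2; omega)
  have hpair : ∀ {X Y}, G.IsOver A X → G.IsOver A Y → X ≠ Y → X ⊆ G.perp Y →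
      G'.dim (meetImage f X ∩ meetImage f Y) = k' - m - 1 := by
    intro X Y hX hY hne hXY
    have sJ := hW.isSingular_span_union hX.1 hY.1 hXY
    -- For m = 0, X and Y are vertices of a common star, so their images share a hyperplane S. For
    -- larger m, the images are distinct hyperplanes of F(⟨X,Y⟩).
    rcases m with _ | m
    · have dX := hX.2.2
      have dY := hY.2.2
      obtain ⟨S, U, sS, dS, sU, dU, h⟩ := hf.exists_star hA (by omega) sJ
        (hX.2.1.trans (Set.subset_union_left.trans (subset_span _)))
      set X' : G.Grassmannian k := ⟨X, hW.hasDim_iff.2 ⟨hX.1, by omega⟩⟩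
      set Y' : G.Grassmannian k := ⟨Y, hW.hasDim_iff.2 ⟨hY.1, by omega⟩⟩
      have e1 : meetImage f X = (f X').1 := hf.meetImage_eq X'
      have e2 : meetImage f Y = (f Y').1 := hf.meetImage_eq Y'
      obtain ⟨s1, d1⟩ := hW'.hasDim_iff.1 (f X').2
      obtain ⟨s2, d2⟩ := hW'.hasDim_iff.1 (f Y').2
      rw [e1, e2, hW'.inter_eq_of_ne sS s1 s2
        (h X' hX.2.1 (Set.subset_union_left.trans (subset_span _))).1
        (h Y' hY.2.1 (Set.subset_union_right.trans (subset_span _))).1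
        (fun e => hne (congrArg Subtype.val (hf.injective (Subtype.ext e)))) (by omega) (by omega),
        dS]
      simp
    · obtain ⟨-, -, -, -, -, -, dJ⟩ :=
        hW.exists_join hA hX.1 hY.1 hX.2.1 hY.2.1 hXY hne hX.2.2 hY.2.2
      have dX := hX.2.2
      have fX := hdim hX
      have fY := hdim hY
      push_cast at *
      have hJ := ih m (by omega) _ sJ (by omega)
      rw [hW'.dim_inter_of_ne (hf.isSingular_meetImage sJ (by omega)) (hsing hX) (hsing hY)
        (meetImage_mono f (Set.subset_union_left.trans (subset_span _)))
        (meetImage_mono f (Set.subset_union_right.trans (subset_span _)))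
        (hf.meetImage_ne hA hX hY hXY hne (by omega) (by omega)) (by omega) (by omega), fX]
  obtain ⟨X, Y, hX, hY, hne, hXY, h⟩ := hW.exists_inter_subset hf.rank hA (by omega)
    (meetImage f) (by
    intro X Y Z hX hY hZ hXneY hXneZ hXY hXZ hYZ hZJ
    have hYneZ : Y ≠ Z := by
      rintro rfl
      exact hZJ (Set.subset_union_right.trans (subset_span _))
    have dX := hX.2.2
    have dY := hY.2.2
    have dZ := hZ.2.2
    have p1 := hpair hX hY hXneY hXY
    have p2 := hpair hX hZ hXneZ hXZ
    have p3 := hpair hY hZ hYneZ hYZ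
    have sXY := (hsing hX).subset_of_inter (hsing hY).1
    have sXZ := (hsing hX).subset_of_inter (hsing hZ).1
    have sYZ := (hsing hY).subset_of_inter (hsing hZ).1
    -- For m = 0 all three lie in one star, and the pairwise intersections are its S. For larger m,
    -- F(Y) ∩ F(Z) ⊆ F(J) ∩ F(J') = F(X), and dimensions force equality.
    rcases m with _ | m
    · have sJ := hW.isSingular_span_union hX.1 hY.1 hXY
      have hXJ : X ⊆ G.span (X ∪ Y) := Set.subset_union_left.trans (subset_span _)
      have hYJ : Y ⊆ G.span (X ∪ Y) := Set.subset_union_right.trans (subset_span _)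
      have hJZ : G.span (X ∪ Y) ⊆ G.perp Z := by
        have := hW.span_subset_perp_span (A := X ∪ Y) (B := Z) (Set.union_subset hXZ hYZ)
        rwa [hZ.1.1.span_eq] at this
      have sV := hW.isSingular_span_union sJ hZ.1 hJZ
      have hJV : G.span (X ∪ Y) ⊆ G.span (G.span (X ∪ Y) ∪ Z) :=
        Set.subset_union_left.trans (subset_span _)
      have hZV : Z ⊆ G.span (G.span (X ∪ Y) ∪ Z) := Set.subset_union_right.trans (subset_span _)
      obtain ⟨S, U, sS, dS, sU, dU, h⟩ := hf.exists_star hA (by omega) sV (hZ.2.1.trans hZV)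
      have hS : ∀ W, G.IsOver A W → W ⊆ G.span (G.span (X ∪ Y) ∪ Z) →
          S ⊆ meetImage f W := by
        intro W hWA hWV
        exact (h ⟨W, hW.hasDim_iff.2 ⟨hWA.1, by have := hWA.2.2; omega⟩⟩ hWA.2.1 hWV).1.trans
          (hf.meetImage_eq _).superset
      have hSX := hS X hX (hXJ.trans hJV)
      have hSY := hS Y hY (hYJ.trans hJV)
      have hSZ := hS Z hZ hZV
      exact (hW'.eq_of_subset_of_dim_le sXY sS (Set.subset_inter hSX hSY) (by omega)).symm.trans
        (hW'.eq_of_subset_of_dim_le sXZ sS (Set.subset_inter hSX hSZ) (by omega))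
    · push_cast at hd
      obtain ⟨-, -, -, -, -, -, dJ⟩ :=
        hW.exists_join hA hX.1 hY.1 hX.2.1 hY.2.1 hXY hXneY hX.2.2 hY.2.2
      obtain ⟨-, -, -, -, -, -, dJ'⟩ :=
        hW.exists_join hA hX.1 hZ.1 hX.2.1 hZ.2.1 hXZ hXneZ hX.2.2 hZ.2.2
      have sJ := hW.isSingular_span_union hX.1 hY.1 hXY
      have sJ' := hW.isSingular_span_union hX.1 hZ.1 hXZ
      set J := G.span (X ∪ Y) with hJdef
      set J' := G.span (X ∪ Z) with hJdef'
      have hXJ : X ⊆ J := Set.subset_union_left.trans (subset_span _)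
      have hYJ : Y ⊆ J := Set.subset_union_right.trans (subset_span _)
      have hXJ' : X ⊆ J' := Set.subset_union_left.trans (subset_span _)
      have hZJ' : Z ⊆ J' := Set.subset_union_right.trans (subset_span _)
      have hJJ : J ≠ J' := by
        intro e
        exact hZJ (e ▸ hZJ')
      have hJp : J ⊆ G.perp J' := by
        refine hW.span_subset_perp_span ?_
        rintro x (hx | hx) z (hz | hz)
        · exact hW.subset_perp hX.1 hx z hz
        · exact hXZ hx z hz
        · exact (hXY hz x hx).symm
        · exact hYZ hx z hz
      have hFJ := ih m (by omega) J sJ (by omega)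
      have hFJ' := ih m (by omega) J' sJ' (by omega)
      have fX := hdim hX
      push_cast at *
      have hFne : meetImage f J ≠ meetImage f J' := by
        -- Here J and J' have dimension k, too large for `meetImage_ne`; injectivity of f is used
        -- instead.
        by_cases hm : m = 0
        · subst hm
          intro e
          have e1 := hf.meetImage_eq ⟨J, hW.hasDim_iff.2 ⟨sJ, by simp at hd; omega⟩⟩
          have e2 := hf.meetImage_eq ⟨J', hW.hasDim_iff.2 ⟨sJ', by simp at hd; omega⟩⟩
          have e3 := hf.injective (Subtype.ext (e1.symm.trans (e.trans e2)))
          exact hJJ (congrArg Subtype.val e3)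
        · exact hf.meetImage_ne hX.1 ⟨sJ, hXJ, dJ⟩ ⟨sJ', hXJ', dJ'⟩ hJp hJJ (by omega) (by omega)
      have hI := hW'.inter_eq_of_ne (hsing hX) (hf.isSingular_meetImage sJ (by omega))
        (hf.isSingular_meetImage sJ' (by omega)) (meetImage_mono f hXJ) (meetImage_mono f hXJ')
        hFne (by omega) (by omega)
      have hsub : meetImage f Y ∩ meetImage f Z ⊆ meetImage f X := by
        rw [← hI]
        exact Set.inter_subset_inter (meetImage_mono f hYJ) (meetImage_mono f hZJ')
      exact (hW'.eq_of_subset_of_dim_le sXY sYZ (fun x hx => ⟨hsub hx, hx.1⟩)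
        (by omega)).symm.trans (hW'.eq_of_subset_of_dim_le sXZ sYZ
          (fun x hx => ⟨hsub hx, hx.2⟩) (by omega)))
  have heq : meetImage f A = meetImage f X ∩ meetImage f Y := by
    refine (Set.subset_inter (meetImage_mono f hX.2.1) (meetImage_mono f hY.2.1)).antisymm ?_
    intro y hy W hAW
    obtain ⟨sW, dW⟩ := hW.hasDim_iff.1 W.2
    obtain ⟨Z, sZ, hAZ, hZW, dZ⟩ := hW.exists_between sW hA hAW (d := G.dim A + 1) (by omega)
      (by omega)
    exact h Z ⟨sZ, hAZ, dZ⟩ hy W hZW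
  rw [heq, hpair hX hY hne hXY]
  push_cast
  omega

/-! ### The induced map on points, the rank inequality and spans. -/

theorem not_meetImage_subset {A : Set P} (hA : G.IsSingular A) {p : P} (hp : p ∈ G.perp A)
    (hpA : p ∉ A) (hd : G.dim A + 1 ≤ k) : ¬ meetImage f {p} ⊆ meetImage f A := by
  have hW := hf.weak
  have hW' := hf.weak'
  have hdp := hW.dim_singleton p
  have hFp := hf.dim_meetImage (isSingular_singleton p) (by omega)
  have sFp := hf.isSingular_meetImage (isSingular_singleton (G := G) p) (by omega)
  obtain ⟨m, hm⟩ := Int.eq_ofNat_of_zero_le (show 0 ≤ G.dim A + 1 by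
    have := neg_one_le_dim (G := G) A
    omega)
  induction m generalizing A with
  | zero =>
    intro h
    have := hW'.dim_mono (hf.isSingular_meetImage hA (by omega)) sFp h
    rw [hFp, hf.dim_meetImage hA (by omega)] at this
    simp at hm
    omega
  | succ m ih =>
    push_cast at hm
    intro h
    have hne : ∅ ⊂ A := by
      refine (Set.empty_subset A).ssubset_of_ne ?_
      rintro rfl
      rw [dim_empty] at hm
      omega
    obtain ⟨B, sB, -, hBA, dB⟩ := hW.exists_hyperplane hA isSingular_empty hne
    have hpB : p ∉ B := fun h => hpA (hBA h)
    have hpB' : p ∈ G.perp B := perp_anti hBA hp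
    have hA' := hW.isOver_span_insert sB hpB' hpB
    have hpA' : p ∈ G.span (insert p B) := subset_span _ (Or.inl rfl)
    have hdA' := hA'.2.2
    -- If F({p}) ⊆ F(A), then q together with F(B) spans both F(A) and F(⟨p,B⟩), contrary to
    -- `meetImage_ne`.
    obtain ⟨q, hq, hqB⟩ := Set.not_subset.1 (ih sB hpB' hpB (by omega) (by omega))
    have sFB := hf.isSingular_meetImage sB (by omega)
    have sFA := hf.isSingular_meetImage hA (by omega)
    have sFA' := hf.isSingular_meetImage hA'.1 (by omega)
    have dFB := hf.dim_meetImage sB (by omega)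
    have dFA := hf.dim_meetImage hA (by omega)
    have dFA' := hf.dim_meetImage hA'.1 (by omega)
    refine hf.meetImage_ne sB ⟨hA, hBA, by omega⟩ hA'
      (hW.subset_perp_span_insert hBA hA hp) (fun e => hpA (e ▸ hpA')) (by omega) dFA ?_
    rw [hW'.eq_span_insert sFA sFB (meetImage_mono f hBA) (by omega) (h hq) hqB,
      hW'.eq_span_insert sFA' sFB (meetImage_mono f hA'.2.1) (by omega)
        (meetImage_mono f (Set.singleton_subset_iff.2 hpA') hq) hqB]

theorem meetImage_singleton_ne {p q : P} (hpq : G.Collinear p q) (hne : p ≠ q) :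
    meetImage f {p} ≠ meetImage f {q} := by
  have h1 := hf.weak.dim_singleton q
  have h2 := hf.one_le
  intro h
  refine hf.not_meetImage_subset (isSingular_singleton q) (p := p) ?_ hne (by omega) h.subset
  rintro _ rfl
  exact hpq

/-- Collinear points lie in a common X, since k ≥ 1, so both images lie in f(X). Conversely, for B ⊆
p^⊥ ∩ q^⊥ of dimension k - 1, perpendicular images would make f(⟨p,B⟩) and f(⟨q,B⟩) adjacent;
reflecting the adjacency makes p and q collinear. -/
theorem collinear_iff {p q : P} :
    G.Collinear p q ↔ meetImage f {p} ⊆ G'.perp (meetImage f {q}) := by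
  have hW := hf.weak
  have hW' := hf.weak'
  have hk1 := hf.one_le
  have hk := hf.le_rank
  have hdp := hW.dim_singleton p
  have hdq := hW.dim_singleton q
  constructor
  · intro hpq
    have hp : p ∈ G.perp {q} := by
      rintro _ rfl
      exact hpq
    have hle := hW.dim_span_insert_le (isSingular_singleton q) hp
    obtain ⟨X, hX⟩ := hf.exists_grassmannian
      (hW.isSingular_span_insert (isSingular_singleton q) hp) (by omega)
    have hX' := (subset_span _).trans hX
    exact fun a ha => hW'.mem_perp_of_mem (hW'.hasDim_iff.1 (f X).2).1
      (fun b (hb : b ∈ meetImage f {q}) => hb X (Set.singleton_subset_iff.2 (hX' (Or.inr rfl))))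
      (ha X (Set.singleton_subset_iff.2 (hX' (Or.inl rfl))))
  · intro h
    by_contra hpq
    obtain ⟨U, hU, hpU, hdU⟩ := hW.exists_maximal hf.rank (isSingular_singleton p)
    have h1 := hW.le_dim_inter_perp_singleton hU q
    obtain ⟨B, sB, -, hBU, dB⟩ := hW.exists_between (hW.isSingular_inter_perp hU {q})
      isSingular_empty (Set.empty_subset _) (d := k - 1) (by rw [dim_empty]; omega) (by omega)
    have hqB : q ∈ G.perp B := fun b hb => ((hBU hb).2 q rfl).symm
    have hpB : p ∈ G.perp B :=
      hW.mem_perp_of_mem hU (hBU.trans Set.inter_subset_left) (hpU rfl)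
    have hp : p ∉ B := fun h => hpq (hqB p h).symm
    have hq : q ∉ B := fun h => hpq (hpB q h)
    have key : ∀ p, p ∈ G.perp B → p ∉ B → ∃ X : G.Grassmannian k, p ∈ X.1 ∧
        ∃ a ∈ meetImage f {p}, a ∈ G'.perp (meetImage f B) ∧ a ∉ meetImage f B ∧
        (f X).1 = G'.span (insert a (meetImage f B)) := by
      intro p hpB hp
      have hX := hW.isOver_span_insert sB hpB hp
      have hX' := hX.2.2
      have hpX : p ∈ G.span (insert p B) := subset_span _ (Or.inl rfl)
      refine ⟨⟨_, hW.hasDim_iff.2 ⟨hX.1, by omega⟩⟩, hpX, ?_⟩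
      obtain ⟨a, ha, haB⟩ := Set.not_subset.1 (hf.not_meetImage_subset sB hpB hp (by omega))
      have sFB := hf.isSingular_meetImage sB (by omega)
      have sFX := hf.isSingular_meetImage hX.1 (by omega)
      have dFB := hf.dim_meetImage sB (by omega)
      have dFX := hf.dim_meetImage hX.1 (by omega)
      have haX := meetImage_mono f (Set.singleton_subset_iff.2 hpX) ha
      have hBX := meetImage_mono f hX.2.1
      refine ⟨a, ha, hW'.mem_perp_of_mem sFX hBX haX, haB, ?_⟩
      exact (hf.meetImage_eq _).symm.trans
        (hW'.eq_span_insert sFX sFB hBX (by omega) haX haB)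
    obtain ⟨X, hpX, a, ha, haB, haB', hfX⟩ := key p hpB hp
    obtain ⟨Y, hqY, b, hb, hbB, hbB', hfY⟩ := key q hqB hq
    have sFB := hf.isSingular_meetImage sB (by omega)
    have hperp : (f X).1 ⊆ G'.perp (f Y).1 := by
      rw [hfX, hfY]
      refine hW'.span_subset_perp_span ?_
      rintro x (rfl | hx) y (rfl | hy)
      · exact h ha _ hb
      · exact haB y hy
      · exact (hbB x hx).symm
      · exact hW'.subset_perp sFB hx y hy
    have hcol : ∀ U, G.IsSingular U → X.1 ⊆ U → Y.1 ⊆ U → False := fun U sU hX hY =>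
      hpq (hW.subset_perp sU (hX hpX) q (hY hqY))
    have sX := (hW.hasDim_iff.1 X.2).1
    obtain ⟨s1, d1⟩ := hW'.hasDim_iff.1 (f X).2
    obtain ⟨s2, d2⟩ := hW'.hasDim_iff.1 (f Y).2
    have dFB := hf.dim_meetImage sB (by omega)
    have hne : f X ≠ f Y := fun e => hcol X.1 sX subset_rfl (by rw [hf.injective e])
    obtain ⟨-, -, -, -, -, -, dJ⟩ := hW'.exists_join sFB s1 s2
      (hfX ▸ (Set.subset_insert _ _).trans (subset_span _))
      (hfY ▸ (Set.subset_insert _ _).trans (subset_span _)) hperp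
      (fun e => hne (Subtype.ext e)) (by omega) (by omega)
    have hadj := hf.adj_of_adj X Y ((hW'.adj_iff hf.succ_lt').2 ⟨hne, _,
      hW'.isSingular_span_union s1 s2 hperp, by omega,
      Set.subset_union_left.trans (subset_span _), Set.subset_union_right.trans (subset_span _)⟩)
    obtain ⟨-, U, sU, -, hXU, hYU⟩ := (hW.adj_iff hf.succ_lt).1 hadj
    exact hcol U sU hXU hYU

/-- Above dimension k no vertex contains A, so F(A) is the whole point set. The span E(A) of F(∅)
and the F({p}) with p ∈ A replaces it; it grows strictly with A, from dimension at least k' - k - 1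
at A = ∅. -/
theorem rank_sub_le : (n : ℤ) - k ≤ (n' : ℤ) - k' := by
  have hW := hf.weak
  have hW' := hf.weak'
  have hd0 : G.dim (∅ : Set P) ≤ k := by
    rw [dim_empty]
    omega
  let E : Set P → Set P' := fun A => G'.span (meetImage f ∅ ∪ ⋃ p ∈ A, meetImage f {p})
  have hsp : ∀ p, G'.IsSingular (meetImage f {p}) := fun p =>
    hf.isSingular_meetImage (isSingular_singleton p) (by rw [hW.dim_singleton]; omega)
  have hEperp : ∀ {A : Set P} {z}, z ∈ G.perp A → meetImage f {z} ⊆ G'.perp (E A) := by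
    intro A z hz
    rw [← (hsp z).1.span_eq]
    refine hW'.span_subset_perp_span ?_
    rintro x hx y (hy | hy)
    · exact hW'.subset_perp (hsp z) hx y (meetImage_mono f (Set.empty_subset _) hy)
    · obtain ⟨a, ha, hy⟩ := Set.mem_iUnion₂.1 hy
      exact hf.collinear_iff.1 (hz a ha) hx y hy
  have hEsub : ∀ {A : Set P} {p}, p ∈ A → meetImage f {p} ⊆ E A := fun {A p} hp =>
    (Set.subset_biUnion_of_mem (u := fun p => meetImage f {p}) hp).trans
      (Set.subset_union_right.trans (subset_span _))
  have hEs : ∀ {A}, G.IsSingular A → G'.IsSingular (E A) := by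
    intro A hA
    refine hW'.isSingular_span (Set.union_subset ?_ (Set.iUnion₂_subset fun p hp => ?_))
    · rintro x hx y (hy | hy)
      · exact hW'.subset_perp (hf.isSingular_meetImage isSingular_empty hd0) hx y hy
      · obtain ⟨a, ha, hy⟩ := Set.mem_iUnion₂.1 hy
        exact hW'.subset_perp (hsp a) (meetImage_mono f (Set.empty_subset _) hx) y hy
    · exact (hEperp (hW.subset_perp hA hp)).trans (perp_anti (subset_span _))
  have hEd : ∀ m : ℕ, ∀ A, G.IsSingular A → G.dim A = m - 1 →
      (k' : ℤ) - k + (m - 1) ≤ G'.dim (E A) := by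
    intro m
    induction m with
    | zero =>
      intro A hA hdA
      have h1 := hW'.dim_mono (hEs hA) (hf.isSingular_meetImage isSingular_empty hd0)
        (Set.subset_union_left.trans (subset_span _))
      rw [hf.dim_meetImage isSingular_empty hd0, dim_empty] at h1
      simpa using h1
    | succ m ih =>
      intro A hA hdA
      push_cast at hdA
      have hne : ∅ ⊂ A := by
        refine (Set.empty_subset A).ssubset_of_ne ?_
        rintro rfl
        rw [dim_empty] at hdA
        omega
      obtain ⟨B, sB, -, hBA, dB⟩ := hW.exists_hyperplane hA isSingular_empty hne
      have hBA' : B ⊂ A := hBA.ssubset_of_ne (by rintro rfl; omega)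
      obtain ⟨p, hpA, hpB⟩ := Set.exists_of_ssubset hBA'
      -- F({z}) is perpendicular to E(B) but not to F({p}) ⊆ E(A), which separates E(B) from E(A).
      obtain ⟨z, hz, hzp⟩ := hW.exists_mem_perp_not_collinear sB hpB
      have hEBA : E B ⊆ E A :=
        span_mono (Set.union_subset_union_right _ (Set.biUnion_subset_biUnion_left hBA))
      have hEBA' : E B ⊂ E A := by
        refine hEBA.ssubset_of_ne fun e => hzp (hf.collinear_iff.2 ?_)
        exact (hEperp hz).trans (perp_anti (e ▸ hEsub hpA))
      have h1 := ih B sB (by omega)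
      have h2 := hW'.dim_lt_of_ssubset (hEs hA) (hEs sB) hEBA'
      push_cast
      omega
  obtain ⟨U, sU, -, dU⟩ := hW.exists_maximal hf.rank isSingular_empty
  have h1 := hEd n U sU dU
  have h2 := hW'.dim_le hf.rank' (hEs sU)
  omega

/-- By induction on dim Y, a subspace containing g(X) contains every quotient point inside F(Y) for
nonempty singular Y ⊆ X: two hyperplanes of Y give distinct hyperplanes of F(Y), to which
`mem_of_hyperplanes` applies. -/
theorem span_image_eq {S : Set P'} (hS : meetImage f ∅ = S)
    (g : P → G'.bigStar S ((k' : ℤ) - k)) (hg : ∀ p, (g p).1 = meetImage f {p})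
    (X : G.Grassmannian k) :
    (G'.quotient S ((k' : ℤ) - k)).span (g '' X.1) = {x | x.1 ⊆ (f X).1} := by
  have hW := hf.weak
  have hW' := hf.weak'
  have hd0 : G.dim (∅ : Set P) ≤ k := by
    rw [dim_empty]
    omega
  have sS : G'.IsSingular S := hS ▸ hf.isSingular_meetImage isSingular_empty hd0
  have dS : G'.dim S = (k' : ℤ) - k - 1 := by
    rw [← hS, hf.dim_meetImage isSingular_empty hd0, dim_empty]
    omega
  obtain ⟨sX, dX⟩ := hW.hasDim_iff.1 X.2
  refine (span_subset (hW'.isSubspace_quotient (hW'.hasDim_iff.1 (f X).2).1.1) ?_).antisymm ?_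
  · rintro _ ⟨p, hp, rfl⟩
    change (g p).1 ⊆ _
    rw [hg, ← hf.meetImage_eq]
    exact meetImage_mono f (Set.singleton_subset_iff.2 hp)
  rintro x hx T ⟨hT, hgT⟩
  suffices ∀ m : ℕ, ∀ Y, G.IsSingular Y → G.dim Y = m → Y ⊆ X.1 →
      ∀ x : G'.bigStar S ((k' : ℤ) - k), x.1 ⊆ meetImage f Y → x ∈ T from
    this k X.1 sX dX subset_rfl x (by rwa [hf.meetImage_eq])
  clear hx x
  intro m
  induction m with
  | zero =>
    intro Y sY dY hYX x hx
    have hne : Y.Nonempty := by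
      by_contra! h
      rw [h, dim_empty] at dY
      simp at dY
    obtain ⟨p, hp⟩ := hne
    have hYp := hW.eq_of_subset_of_dim_le sY (isSingular_singleton p)
      (Set.singleton_subset_iff.2 hp) (by rw [hW.dim_singleton, dY]; simp)
    have hxp : x = g p := by
      obtain ⟨sx, dx⟩ := hW'.hasDim_iff.1 x.2.1
      obtain ⟨sp, dp⟩ := hW'.hasDim_iff.1 (g p).2.1
      refine Subtype.ext (hW'.eq_of_subset_of_dim_le sp sx ?_ (by omega))
      rw [hg, hYp]
      exact hx
    rw [hxp]
    exact hgT ⟨p, hYX hp, rfl⟩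
  | succ m ih =>
    intro Y sY dY hYX x hx
    push_cast at dY
    have hkY := hW.dim_mono sX sY hYX
    have hne : ∅ ⊂ Y := by
      refine (Set.empty_subset Y).ssubset_of_ne ?_
      rintro rfl
      rw [dim_empty] at dY
      omega
    obtain ⟨A, sA, -, hAY, dA⟩ := hW.exists_hyperplane sY isSingular_empty hne
    have hneA : ∅ ⊂ A := by
      refine (Set.empty_subset A).ssubset_of_ne ?_
      rintro rfl
      rw [dim_empty] at dA
      omega
    obtain ⟨B, sB, -, hBA, dB⟩ := hW.exists_hyperplane sA isSingular_empty hneA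
    obtain ⟨p, hpY, hpA⟩ : ∃ p ∈ Y, p ∉ A := by
      by_contra! h
      have := hW.dim_mono sA sY h
      omega
    have hA' := hW.isOver_span_insert sB (hW.mem_perp_of_mem sY (hBA.trans hAY) hpY)
      (fun h => hpA (hBA h))
    have hA'Y : G.span (insert p B) ⊆ Y :=
      span_subset sY.1 (Set.insert_subset hpY (hBA.trans hAY))
    have dA' := hA'.2.2
    have dFA := hf.dim_meetImage sA (by omega)
    have dFA' := hf.dim_meetImage hA'.1 (by omega)
    have dFY := hf.dim_meetImage sY (by omega)
    have hFne := hf.meetImage_ne sB ⟨sA, hBA, by omega⟩ hA'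
      (fun a ha => hW.mem_perp_of_mem sY hA'Y (hAY ha))
      (fun e => hpA (e ▸ subset_span _ (Or.inl rfl))) (by omega) dFA
    exact hW'.mem_of_hyperplanes sS dS (hf.isSingular_meetImage sY (by omega))
      (hf.isSingular_meetImage sA (by omega)) (hf.isSingular_meetImage hA'.1 (by omega))
      (meetImage_mono f hAY) (meetImage_mono f hA'Y)
      (hS ▸ meetImage_mono f (Set.empty_subset _)) (hS ▸ meetImage_mono f (Set.empty_subset _))
      (by omega) (by omega) hFne hT (ih A sA (by omega) (hAY.trans hYX))
      (ih _ hA'.1 (by omega) (hA'Y.trans hYX)) hx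

end IsStarEmbedding

end PointLineGeometry

/- In the conclusion, `G'.quotient S (k' - k)` is the quotient polar space of `G'` by the
`(k' - k - 1)`-dimensional subspace `S`. A `k`-dimensional singular subspace of it is the set of
all its points contained in some `k'`-dimensional singular subspace `V ⊇ S` of `G'`, with which it
is identified; so the last line says that `f` sends `X` to the span of `g(X)`. -/
theorem proposition2 {P P' : Type*} (G : PointLineGeometry P) (G' : PointLineGeometry P')
    (n n' k k' : ℕ)
    (hG : G.IsPolarSpace ∨ G.IsThinPolarSpace) (hn : G.HasRank n)
    (hG' : G'.IsPolarSpace) (hn' : G'.HasRank n')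
    (hk : 1 ≤ k) (hkn : k + 3 ≤ n) (hk' : k' + 1 ≤ n')
    (f : G.grassmannGraph n k ↪g G'.grassmannGraph n' k')
    (hf : ∀ X Y, (G'.grassmannGraph n' k').edist (f X) (f Y) = (G.grassmannGraph n k).edist X Y)
    (hstar : ∀ 𝒳, G.IsStar n k 𝒳 → ∃ 𝒴, G'.IsStar n' k' 𝒴 ∧ f '' 𝒳 ⊆ 𝒴) :
    (n : ℤ) - k ≤ (n' : ℤ) - k' ∧
    ∃ S : Set P', G'.HasDim S ((k' : ℤ) - k - 1) ∧
      (∀ X, (f X).1 ∈ G'.bigStar S k') ∧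
      ∃ g : P → G'.bigStar S ((k' : ℤ) - k),
        G.IsCollinearityPreservingInjection (G'.quotient S ((k' : ℤ) - k)) g ∧
        ∀ X, (G'.quotient S ((k' : ℤ) - k)).span (g '' X.1) = {x | x.1 ⊆ (f X).1} := by
  have hW : G.IsWeakPolarSpace := hG.elim (·.isWeakPolarSpace)
    fun h => h.isWeakPolarSpace hn (by omega)
  have hW' := hG'.isWeakPolarSpace
  have hf' : G.IsStarEmbedding G' n n' k k' f :=
    ⟨hW, hW', hn, hn', hk, hkn, hk', f.injective, fun _ _ => f.map_adj_iff.1, hf, hstar⟩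
  have hd0 : G.dim (∅ : Set P) ≤ k := by
    rw [PointLineGeometry.dim_empty]
    omega
  have sS := hf'.isSingular_meetImage PointLineGeometry.isSingular_empty hd0
  have dS : G'.dim (PointLineGeometry.meetImage f ∅) = (k' : ℤ) - k - 1 := by
    rw [hf'.dim_meetImage PointLineGeometry.isSingular_empty hd0, PointLineGeometry.dim_empty]
    omega
  have hp : ∀ p, G.dim {p} ≤ k := fun p => by
    rw [hW.dim_singleton]
    omega
  let g : P → G'.bigStar (PointLineGeometry.meetImage f ∅) ((k' : ℤ) - k) := fun p =>
    ⟨PointLineGeometry.meetImage f {p}, hW'.hasDim_iff.2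
      ⟨hf'.isSingular_meetImage (PointLineGeometry.isSingular_singleton p) (hp p), by
        rw [hf'.dim_meetImage (PointLineGeometry.isSingular_singleton p) (hp p),
          hW.dim_singleton, add_zero]⟩,
      PointLineGeometry.meetImage_mono _ (Set.empty_subset _)⟩
  have hg : Function.Injective g := by
    intro p q hpq
    have hpq' : PointLineGeometry.meetImage f {p} = PointLineGeometry.meetImage f {q} :=
      congrArg Subtype.val hpq
    by_contra hne
    refine hf'.meetImage_singleton_ne (hf'.collinear_iff.2 ?_) hne hpq'
    rw [hpq']
    exact hW'.subset_perp (hf'.isSingular_meetImage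
      (PointLineGeometry.isSingular_singleton q) (hp q))
  refine ⟨hf'.rank_sub_le, _, hW'.hasDim_iff.2 ⟨sS, dS⟩, fun X => ⟨(f X).2, ?_⟩, g, ⟨hg, ?_⟩, ?_⟩
  · exact fun y hy => hy X (Set.empty_subset _)
  · intro x y hxy
    rw [hW'.quotient_collinear_iff sS dS (hg.ne hxy)]
    exact hf'.collinear_iff
  · exact hf'.span_image_eq rfl g fun _ => rfl
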